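/- Let $k$ be a field and let $\mathcal B$ be a skeletally small, Krull–Schmidt, Hom-finite, $k$-linear extriangulated category $(\mathcal B,\mathbb E,\mathfrak s)$ (in the sense of Nakaoka–Palu) with enough projectives and enough injectives. Assume that $\mathcal B$ satisfies (WIC): for morphisms $f:A\to B$ and $g:B\to C$, if $g\circ f$ is an inflation then so is $f$, and if $g\circ f$ is a deflation then so is $g$. Subcategories are full. A subcategory is called additive if it is closed under isomorphisms, finite direct sums and direct summands. Let $\Omega^0X=X$ and let $\Omega^{i}X$ be given by $\mathbb E$-triangles $\Omega^{i}X\to P\to\Omega^{i-1}X\dashrightarrow$ with $P$ projective; put $\mathbb E^{i+1}(X,Y)=\mathbb E(\Omega^iX,Y)$ for $i\ge 0$. For a subcategory $\mathcal W$ put - $\mathcal W^{\bot}=\{X\mid \mathbb E^i(\mathcal W,X)=0\ \forall i>0\}$ and ${}^{\bot}\mathcal W=\{X\mid \mathbb E^i(X,\mathcal W)=0\ \forall i>0\}$; - $\mathcal W^\wedge=\bigcup_{i\ge0}\mathcal W^\wedge_i$, where $\mathcal W^\wedge_0=\mathcal W$ and $X\in\mathcal W^\wedge_i$ iff there is an $\mathbb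 E$-triangle $C\to W\to X\dashrightarrow$ with $C\in \mathcal W^\wedge_{i-1}$, $W\in\mathcal W$; - $\mathcal W^\vee=\bigcup_{i\ge0}\mathcal W^\vee_i$, where $\mathcal W^\vee_0=\mathcal W$ and $X\in\mathcal W^\vee_i$ iff there is an $\mathbb E$-triangle $X\to W\to D\dashrightarrow$ with $W\in\mathcal W$, $D\in \mathcal W^\vee_{i-1}$; - $\mathsf{thick}\,\mathcal W$ is the smallest additive subcategory that contains $\mathcal W$ and contains the third term of any $\mathbb E$-triangle as soon as it contains two of its terms. A pair $(\mathcal U,\mathcal V)$ of additive subcategories is a cotorsion pair if $\mathbb E(\mathcal U,\mathcal V)=0$ and every object $X$ admits $\mathbb E$-triangles $V\to U\to X\dashrightarrow$ and $X\to V'\to U'\dashrightarrow$ with $U,U'\in\mathcal U$ and $V,V'\in\mathcal V$. Let $\mathcal W$ be a presilting subcategory of $\mathcal B$ (an additive subcategory with $\mathbb E^i(\mathcal W,\mathcal W)=0$ for all $i\ge1$) that satisfies (CP) $(\mathcal W^\vee,\mathcal W^\bot)$ and $({}^\bot\mathcal W,\mathcal W^\wedge)$ are cotorsion pairs in $\mathcal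 B$. Let $\mathcal Z={}^\bot\mathcal W\cap\mathcal W^\bot$, and let $\mathcal Z/[\mathcal W]$ be the category with the objects of $\mathcal Z$ whose morphisms are those of $\mathcal Z$ modulo the morphisms that factor through an object of $\mathcal W$. Let $\mathcal R$ be the class of the morphisms $f:A\to B$ that occur in an $\mathbb E$-triangle $A\xrightarrow{f}B\to M\dashrightarrow$ with $M\in\mathsf{thick}\,\mathcal W$, and let $L_{\mathcal R}:\mathcal B\to\mathcal B/(\mathsf{thick}\,\mathcal W)$ be the Gabriel–Zisman localization of $\mathcal B$ with respect to $\mathcal R$. Then: 1. The category $\mathcal B/(\mathsf{thick}\,\mathcal W)$ is equivalent to $\mathcal Z/[\mathcal W]$. 2. One can choose for every object $B$ two $\mathbb E$-triangles $$B\xrightarrow{b^+}B^+\to U_B\dashrightarrow,\qquad V^B\to Z_B\xrightarrow{z_B}B^+\dashrightarrow$$ with $U_B\in\mathcal W^\vee$, $B^+\in\mathcal W^\bot$, $V^B\in\mathcal W^\wedge$, $Z_B\in\mathcal Z$, such that moreover $b^+$ is a minimal left $\mathcal W^\bot$-approximation and $z_B$ is a minimal right ${}^\bot\mathcal W$-approximation.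 3. For every choice of two such $\mathbb E$-triangles for every object $B$ (with $b^+$, $z_B$ minimal or not): for every morphism $f:B\to C$ there are $f^+:B^+\to C^+$ and $z_f:Z_B\to Z_C$ with $f^+b^+=c^+f$ and $z_Cz_f=f^+z_B$; the class $\overline{z_f}$ of $z_f$ in $\mathcal Z/[\mathcal W]$ depends only on $f$; the assignment $G(B)=Z_B$, $G(f)=\overline{z_f}$ is a functor $G:\mathcal B\to\mathcal Z/[\mathcal W]$; $G$ sends all morphisms of $\mathcal R$ to isomorphisms; and the unique functor $H:\mathcal B/(\mathsf{thick}\,\mathcal W)\to\mathcal Z/[\mathcal W]$ with $H\circ L_{\mathcal R}=G$ is an equivalence. -/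

import Mathlib

open CategoryTheory CategoryTheory.Limits Opposite

universe w v u

/-! ### Extriangulated categories -/

/-- For a bifunctor `E : Cᵒᵖ × C → Ab`, the group `E(X, A)` of extensions of `X` by `A`. -/
abbrev ExtGroup {C : Type u} [Category.{v} C] (E : Cᵒᵖ ⥤ C ⥤ AddCommGrpCat.{w}) (X A : C) :
    Type w :=
  ((E.obj (op X)).obj A : AddCommGrpCat.{w})

/-- The push-forward `a_* δ = E(X, a)(δ)`. -/
def extPush {C : Type u} [Category.{v} C] (E : Cᵒᵖ ⥤ C ⥤ AddCommGrpCat.{w}) {X A A' : C}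
    (a : A ⟶ A') (δ : ExtGroup E X A) : ExtGroup E X A' :=
  ((E.obj (op X)).map a).hom δ

/-- The pull-back `c^* δ = E(c, A)(δ)`. -/
def extPull {C : Type u} [Category.{v} C] (E : Cᵒᵖ ⥤ C ⥤ AddCommGrpCat.{w}) {X X' A : C}
    (c : X' ⟶ X) (δ : ExtGroup E X A) : ExtGroup E X' A :=
  ((E.map c.op).app A).hom δ

/-- The direct sum of extensions: the element of `E(X ⊞ X', A ⊞ A')` that corresponds to
`(δ, 0, 0, δ')` under `E(X ⊞ X', A ⊞ A') ≅ E(X, A) ⊕ E(X, A') ⊕ E(X', A) ⊕ E(X', A')`. -/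
noncomputable def extSum {C : Type u} [Category.{v} C] [Preadditive C] [HasBinaryBiproducts C]
    (E : Cᵒᵖ ⥤ C ⥤ AddCommGrpCat.{w}) {X A X' A' : C}
    (δ : ExtGroup E X A) (δ' : ExtGroup E X' A') : ExtGroup E (X ⊞ X') (A ⊞ A') :=
  extPull E biprod.fst (extPush E biprod.inl δ) + extPull E biprod.snd (extPush E biprod.inr δ')

/-- The structure of an extriangulated category (Nakaoka--Palu) on an additive category `C`:
an additive bifunctor `E` together with an additive realization `s` satisfying (ET3), (ET4) and
their duals. The realization is given by the relation `Realizes δ x y`, which says that the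
sequence `A ⟶ B ⟶ X` of `x` and `y` belongs to the class `s(δ)`; the fields `exists_realization`,
`realization_unique` and `realization_closed` say that `s(δ)` is precisely one class of sequences
`A ⟶ B ⟶ X` modulo isomorphisms of the middle term that are the identity on `A` and `X`. -/
structure ExtriangulatedStructure (C : Type u) [Category.{v} C] [Preadditive C]
    [HasBinaryBiproducts C] where
  /-- the bifunctor of extensions -/
  E : Cᵒᵖ ⥤ C ⥤ AddCommGrpCat.{w}
  additive_right : ∀ X : Cᵒᵖ, (E.obj X).Additive
  additive_left : ∀ A : C, (E.flip.obj A).Additive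
  /-- `(A ⟶ B ⟶ X, δ)` is an `E`-triangle -/
  Realizes : ∀ {A B X : C}, ExtGroup E X A → (A ⟶ B) → (B ⟶ X) → Prop
  exists_realization : ∀ {A X : C} (δ : ExtGroup E X A),
    ∃ (B : C) (x : A ⟶ B) (y : B ⟶ X), Realizes δ x y
  realization_unique : ∀ {A B B' X : C} (δ : ExtGroup E X A) (x : A ⟶ B) (y : B ⟶ X)
    (x' : A ⟶ B') (y' : B' ⟶ X), Realizes δ x y → Realizes δ x' y' →
    ∃ b : B ≅ B', x ≫ b.hom = x' ∧ b.hom ≫ y' = y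
  realization_closed : ∀ {A B B' X : C} (δ : ExtGroup E X A) (x : A ⟶ B) (y : B ⟶ X)
    (b : B ≅ B'), Realizes δ x y → Realizes δ (x ≫ b.hom) (b.inv ≫ y)
  /-- `s` is a realization: morphisms of extensions lift to morphisms of sequences -/
  realization_map : ∀ {A B X A' B' X' : C} (δ : ExtGroup E X A) (δ' : ExtGroup E X' A')
    (x : A ⟶ B) (y : B ⟶ X) (x' : A' ⟶ B') (y' : B' ⟶ X'),
    Realizes δ x y → Realizes δ' x' y' →
    ∀ (a : A ⟶ A') (c : X ⟶ X'), extPush E a δ = extPull E c δ' →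
      ∃ b : B ⟶ B', x ≫ b = a ≫ x' ∧ y ≫ c = b ≫ y'
  /-- `s` is additive: the zero extension is realized by the split sequence -/
  realizes_zero : ∀ A X : C,
    Realizes (0 : ExtGroup E X A) (biprod.inl : A ⟶ A ⊞ X) (biprod.snd : A ⊞ X ⟶ X)
  /-- `s` is additive: direct sums of extensions are realized by direct sums of sequences -/
  realizes_sum : ∀ {A B X A' B' X' : C} (δ : ExtGroup E X A) (δ' : ExtGroup E X' A')
    (x : A ⟶ B) (y : B ⟶ X) (x' : A' ⟶ B') (y' : B' ⟶ X'),
    Realizes δ x y → Realizes δ' x' y' →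
      Realizes (extSum E δ δ') (biprod.map x x') (biprod.map y y')
  /-- the axiom (ET3) -/
  et3 : ∀ {A B X A' B' X' : C} (δ : ExtGroup E X A) (δ' : ExtGroup E X' A')
    (x : A ⟶ B) (y : B ⟶ X) (x' : A' ⟶ B') (y' : B' ⟶ X'),
    Realizes δ x y → Realizes δ' x' y' →
    ∀ (a : A ⟶ A') (b : B ⟶ B'), x ≫ b = a ≫ x' →
      ∃ c : X ⟶ X', y ≫ c = b ≫ y' ∧ extPush E a δ = extPull E c δ'
  /-- the dual of the axiom (ET3) -/
  et3_op : ∀ {A B X A' B' X' : C} (δ : ExtGroup E X A) (δ' : ExtGroup E X' A')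
    (x : A ⟶ B) (y : B ⟶ X) (x' : A' ⟶ B') (y' : B' ⟶ X'),
    Realizes δ x y → Realizes δ' x' y' →
    ∀ (b : B ⟶ B') (c : X ⟶ X'), y ≫ c = b ≫ y' →
      ∃ a : A ⟶ A', x ≫ b = a ≫ x' ∧ extPush E a δ = extPull E c δ'
  /-- the axiom (ET4) -/
  et4 : ∀ {A B X D F : C} (δ : ExtGroup E D A) (δ' : ExtGroup E F B)
    (f : A ⟶ B) (f' : B ⟶ D) (g : B ⟶ X) (g' : X ⟶ F),
    Realizes δ f f' → Realizes δ' g g' →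
    ∃ (G : C) (h' : X ⟶ G) (d : D ⟶ G) (e : G ⟶ F) (δ'' : ExtGroup E G A),
      Realizes δ'' (f ≫ g) h' ∧ f' ≫ d = g ≫ h' ∧ h' ≫ e = g' ∧
      Realizes (extPush E f' δ') d e ∧
      extPull E d δ'' = δ ∧
      extPush E f δ'' = extPull E e δ'
  /-- the dual of the axiom (ET4) -/
  et4_op : ∀ {A B X D F : C} (δ : ExtGroup E B D) (δ' : ExtGroup E X F)
    (f' : D ⟶ A) (f : A ⟶ B) (g' : F ⟶ B) (g : B ⟶ X),
    Realizes δ f' f → Realizes δ' g' g →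
    ∃ (G : C) (h' : G ⟶ A) (d : D ⟶ G) (e : G ⟶ F) (δ'' : ExtGroup E X G),
      Realizes δ'' h' (f ≫ g) ∧ d ≫ h' = f' ∧ h' ≫ f = e ≫ g' ∧
      Realizes (extPull E g' δ) d e ∧
      extPush E e δ'' = δ' ∧
      extPush E d δ = extPull E g δ''

/-! ### Krull--Schmidt categories, subcategories, approximations -/

/-- Every object is a finite direct sum of objects with local endomorphism rings. -/
def IsKrullSchmidt (C : Type u) [Category.{v} C] [Preadditive C] : Prop :=
  ∀ A : C, ∃ (n : ℕ) (X : Fin n → C) (b : Bicone X),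
    Nonempty b.IsBilimit ∧ Nonempty (A ≅ b.pt) ∧ ∀ i, IsLocalRing (End (X i))

/-- The standing convention on (full) subcategories: closed under isomorphisms, finite direct
sums (including the zero object) and direct summands. -/
structure IsAdditiveSubcategory {C : Type u} [Category.{v} C] [Preadditive C]
    [HasBinaryBiproducts C] (P : ObjectProperty C) : Prop where
  of_iso : ∀ {X Y : C}, (X ≅ Y) → P X → P Y
  of_isZero : ∀ {X : C}, IsZero X → P X
  biprod : ∀ {X Y : C}, P X → P Y → P (X ⊞ Y)
  summand : ∀ {X Y : C}, P (X ⊞ Y) → P X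

/-- `f : X ⟶ Y` is a minimal left `P`-approximation. -/
def IsMinimalLeftApprox {C : Type u} [Category.{v} C] (P : ObjectProperty C) {X Y : C}
    (f : X ⟶ Y) : Prop :=
  P Y ∧ (∀ (Y' : C) (g : X ⟶ Y'), P Y' → ∃ h : Y ⟶ Y', f ≫ h = g) ∧
    ∀ φ : Y ⟶ Y, f ≫ φ = f → IsIso φ

/-- `f : X ⟶ Y` is a minimal right `P`-approximation. -/
def IsMinimalRightApprox {C : Type u} [Category.{v} C] (P : ObjectProperty C) {X Y : C}
    (f : X ⟶ Y) : Prop :=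
  P X ∧ (∀ (X' : C) (g : X' ⟶ Y), P X' → ∃ h : X' ⟶ X, h ≫ f = g) ∧
    ∀ φ : X ⟶ X, φ ≫ f = f → IsIso φ

/-- `f` factors through an object of `P`. -/
def FactorsThroughObj {C : Type u} [Category.{v} C] (P : ObjectProperty C) {X Y : C}
    (f : X ⟶ Y) : Prop :=
  ∃ (S : C) (g : X ⟶ S) (h : S ⟶ Y), P S ∧ g ≫ h = f

namespace ExtriangulatedStructure

variable {C : Type u} [Category.{v} C] [Preadditive C] [HasBinaryBiproducts C]
  (T : ExtriangulatedStructure.{w} C)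

/-! ### Inflations, projectives, higher extensions -/

/-- `A ⟶ B ⟶ X` is (the underlying sequence of) an `E`-triangle. -/
def IsTriangle {A B X : C} (x : A ⟶ B) (y : B ⟶ X) : Prop :=
  ∃ δ : ExtGroup T.E X A, T.Realizes δ x y

def IsInflation {A B : C} (x : A ⟶ B) : Prop :=
  ∃ (X : C) (y : B ⟶ X), T.IsTriangle x y

def IsDeflation {B X : C} (y : B ⟶ X) : Prop :=
  ∃ (A : C) (x : A ⟶ B), T.IsTriangle x y

/-- The condition (WIC). -/
def WIC : Prop :=
  ∀ {A B X : C} (f : A ⟶ B) (g : B ⟶ X),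
    (T.IsInflation (f ≫ g) → T.IsInflation f) ∧ (T.IsDeflation (f ≫ g) → T.IsDeflation g)

def IsProjectiveObj (P : C) : Prop :=
  ∀ {A B X : C} (x : A ⟶ B) (y : B ⟶ X), T.IsTriangle x y →
    ∀ c : P ⟶ X, ∃ b : P ⟶ B, b ≫ y = c

def IsInjectiveObj (I : C) : Prop :=
  ∀ {A B X : C} (x : A ⟶ B) (y : B ⟶ X), T.IsTriangle x y →
    ∀ a : A ⟶ I, ∃ b : B ⟶ I, x ≫ b = a

def HasEnoughProjectives : Prop :=
  ∀ X : C, ∃ (A P : C) (x : A ⟶ P) (y : P ⟶ X), T.IsProjectiveObj P ∧ T.IsTriangle x y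

def HasEnoughInjectives : Prop :=
  ∀ A : C, ∃ (I X : C) (x : A ⟶ I) (y : I ⟶ X), T.IsInjectiveObj I ∧ T.IsTriangle x y

/-- `T.IsSyzygy n X K`: the object `K` is an `n`-th syzygy `Ωⁿ X` of `X`. -/
inductive IsSyzygy : ℕ → C → C → Prop
  | zero (X : C) : IsSyzygy 0 X X
  | succ {n : ℕ} {X K K' P : C} (x : K' ⟶ P) (y : P ⟶ K) : IsSyzygy n X K →
      T.IsProjectiveObj P → T.IsTriangle x y → IsSyzygy (n + 1) X K'

/-- `Eⁱ(X, Y) = 0` for all `i ≥ 1`, where `Eⁿ⁺¹(X, Y) = E(Ωⁿ X, Y)`. (Syzygies exist when there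
are enough projectives, and the vanishing does not depend on the choice of the syzygy.) -/
def HigherExtVanish (X Y : C) : Prop :=
  ∀ (n : ℕ) (K : C), T.IsSyzygy n X K → ∀ δ : ExtGroup T.E K Y, δ = 0

/-! ### Subcategories attached to a subcategory -/

/-- `Cone(P, Q)`. -/
def cone (P Q : ObjectProperty C) : ObjectProperty C := fun X =>
  ∃ (A B : C) (x : A ⟶ B) (y : B ⟶ X), P A ∧ Q B ∧ T.IsTriangle x y

/-- `CoCone(P, Q)`. -/
def cocone (P Q : ObjectProperty C) : ObjectProperty C := fun X =>
  ∃ (A B : C) (x : X ⟶ A) (y : A ⟶ B), P A ∧ Q B ∧ T.IsTriangle x y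

/-- `P^∧_n`. -/
def wedgeAux (P : ObjectProperty C) : ℕ → ObjectProperty C
  | 0 => P
  | n + 1 => T.cone (wedgeAux P n) P

/-- `P^∨_n`. -/
def veeAux (P : ObjectProperty C) : ℕ → ObjectProperty C
  | 0 => P
  | n + 1 => T.cocone P (veeAux P n)

/-- `P^∧`, the union of the `P^∧_n`. -/
def wedge (P : ObjectProperty C) : ObjectProperty C := fun X => ∃ n, T.wedgeAux P n X

/-- `P^∨`, the union of the `P^∨_n`. -/
def vee (P : ObjectProperty C) : ObjectProperty C := fun X => ∃ n, T.veeAux P n X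

/-- `P^⊥`: the objects `X` with `Eⁱ(P, X) = 0` for all `i > 0`. -/
def rightPerp (P : ObjectProperty C) : ObjectProperty C := fun X =>
  ∀ S : C, P S → T.HigherExtVanish S X

/-- `^⊥P`: the objects `X` with `Eⁱ(X, P) = 0` for all `i > 0`. -/
def leftPerp (P : ObjectProperty C) : ObjectProperty C := fun X =>
  ∀ S : C, P S → T.HigherExtVanish X S

def IsPresilting (P : ObjectProperty C) : Prop :=
  IsAdditiveSubcategory P ∧ ∀ S S' : C, P S → P S' → T.HigherExtVanish S S'

structure IsCotorsionPair (P Q : ObjectProperty C) : Prop where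
  left : IsAdditiveSubcategory P
  right : IsAdditiveSubcategory Q
  ext_eq_zero : ∀ X Y : C, P X → Q Y → ∀ δ : ExtGroup T.E X Y, δ = 0
  mem_cone : ∀ X : C, T.cone Q P X
  mem_cocone : ∀ X : C, T.cocone Q P X

/-- The condition (CP). -/
def CP (P : ObjectProperty C) : Prop :=
  T.IsCotorsionPair (T.vee P) (T.rightPerp P) ∧ T.IsCotorsionPair (T.leftPerp P) (T.wedge P)

/-- A thick subcategory: two out of three for `E`-triangles. -/
structure IsThick (P : ObjectProperty C) : Prop where
  additive : IsAdditiveSubcategory P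
  mem₁ : ∀ {A B X : C} (x : A ⟶ B) (y : B ⟶ X), T.IsTriangle x y → P B → P X → P A
  mem₂ : ∀ {A B X : C} (x : A ⟶ B) (y : B ⟶ X), T.IsTriangle x y → P A → P X → P B
  mem₃ : ∀ {A B X : C} (x : A ⟶ B) (y : B ⟶ X), T.IsTriangle x y → P A → P B → P X

/-- `thick P`, the smallest thick subcategory containing `P`. -/
def thick (P : ObjectProperty C) : ObjectProperty C := fun X =>
  ∀ Q : ObjectProperty C, T.IsThick Q → P ≤ Q → Q X

/-- The class of the morphisms `f` that occur in an `E`-triangle `A ⟶ B ⟶ M` whose first map is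
`f` and with `M ∈ thick P`. -/
def thickInflations (P : ObjectProperty C) : MorphismProperty C := fun _ B f =>
  ∃ (M : C) (g : B ⟶ M), T.thick P M ∧ T.IsTriangle f g

/-- The Gabriel--Zisman localization `C / thick P`. -/
abbrev thickLocalization (P : ObjectProperty C) := (T.thickInflations P).Localization

/-! ### The subfactor category -/

/-- `^⊥P ∩ P^⊥`. -/
def zProp (P : ObjectProperty C) : ObjectProperty C := T.leftPerp P ⊓ T.rightPerp P

/-- Two morphisms of the full subcategory `^⊥P ∩ P^⊥` are identified when their difference factors
through an object of `P`. -/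
def idealRel (P : ObjectProperty C) : HomRel (T.zProp P).FullSubcategory :=
  fun _ _ f g => FactorsThroughObj P (f.hom - g.hom)

/-- The subfactor category `(^⊥P ∩ P^⊥) / [P]`. -/
abbrev subfactor (P : ObjectProperty C) := CategoryTheory.Quotient (T.idealRel P)

/-- The object of the subfactor category given by an object of `^⊥P ∩ P^⊥`. -/
abbrev subfactorObj (P : ObjectProperty C) (X : C) (hX : T.zProp P X) : T.subfactor P :=
  (CategoryTheory.Quotient.functor (T.idealRel P)).obj ⟨X, hX⟩

/-- The class in the subfactor category of a morphism of `^⊥P ∩ P^⊥`. -/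
abbrev subfactorMap (P : ObjectProperty C) {X Y : C} (hX : T.zProp P X) (hY : T.zProp P Y)
    (f : X ⟶ Y) : T.subfactorObj P X hX ⟶ T.subfactorObj P Y hY :=
  (CategoryTheory.Quotient.functor (T.idealRel P)).map (ObjectProperty.homMk f)

/-! ### The functor given by approximations -/

/-- A choice, for every object `X`, of `E`-triangles `X ⟶ X⁺ ⟶ U` and `V ⟶ Z ⟶ X⁺` with
`U ∈ P^∨`, `X⁺ ∈ P^⊥`, `V ∈ P^∧` and `Z ∈ ^⊥P ∩ P^⊥`. -/
structure ApproxChoice (P : ObjectProperty C) where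
  plus : C → C
  U : C → C
  b : ∀ X : C, X ⟶ plus X
  u : ∀ X : C, plus X ⟶ U X
  triangle_plus : ∀ X : C, T.IsTriangle (b X) (u X)
  plus_mem : ∀ X : C, T.rightPerp P (plus X)
  U_mem : ∀ X : C, T.vee P (U X)
  V : C → C
  Z : C → C
  i : ∀ X : C, V X ⟶ Z X
  z : ∀ X : C, Z X ⟶ plus X
  triangle_Z : ∀ X : C, T.IsTriangle (i X) (z X)
  V_mem : ∀ X : C, T.wedge P (V X)
  Z_mem : ∀ X : C, T.zProp P (Z X)

namespace ApproxChoice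

variable {T} {P : ObjectProperty C} (A : T.ApproxChoice P)

/-- The chosen maps `X ⟶ X⁺` are minimal left `P^⊥`-approximations and the chosen maps `Z ⟶ X⁺`
are minimal right `^⊥P`-approximations. -/
def IsMinimal : Prop :=
  ∀ X : C, IsMinimalLeftApprox (T.rightPerp P) (A.b X) ∧
    IsMinimalRightApprox (T.leftPerp P) (A.z X)

/-- `ζ : Z_X ⟶ Z_Y` lies over `f : X ⟶ Y`: for some `f⁺ : X⁺ ⟶ Y⁺` the squares with `f`, `f⁺` and
with `ζ`, `f⁺` commute. (By (ET3) and its dual, these squares are the same thing as morphisms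
between the chosen `E`-triangles with first component `f`, middle component `f⁺`, respectively
middle component `ζ`, last component `f⁺`.) -/
def IsLift {X Y : C} (f : X ⟶ Y) (ζ : A.Z X ⟶ A.Z Y) : Prop :=
  ∃ fp : A.plus X ⟶ A.plus Y, A.b X ≫ fp = f ≫ A.b Y ∧ ζ ≫ A.z Y = A.z X ≫ fp

/-- The data of the functor to the subfactor category that sends `X` to `Z_X` and `f` to the class
of any `ζ` lying over `f`. -/
structure InducedFunctor where
  map : ∀ {X Y : C}, (X ⟶ Y) →
    (T.subfactorObj P (A.Z X) (A.Z_mem X) ⟶ T.subfactorObj P (A.Z Y) (A.Z_mem Y))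
  map_id : ∀ X : C, map (𝟙 X) = 𝟙 _
  map_comp : ∀ {X Y Y' : C} (f : X ⟶ Y) (g : Y ⟶ Y'), map (f ≫ g) = map f ≫ map g
  exists_lift : ∀ {X Y : C} (f : X ⟶ Y), ∃ ζ : A.Z X ⟶ A.Z Y, A.IsLift f ζ
  map_eq : ∀ {X Y : C} (f : X ⟶ Y) (ζ : A.Z X ⟶ A.Z Y), A.IsLift f ζ →
    map f = T.subfactorMap P (A.Z_mem X) (A.Z_mem Y) ζ

/-- The functor underlying `InducedFunctor`. -/
def InducedFunctor.functor {A : T.ApproxChoice P} (G : A.InducedFunctor) :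
    C ⥤ T.subfactor P where
  obj X := T.subfactorObj P (A.Z X) (A.Z_mem X)
  map f := G.map f
  map_id X := G.map_id X
  map_comp f g := G.map_comp f g

end ApproxChoice

end ExtriangulatedStructure

/-! ### Isomorphism criteria for endomorphisms and composites -/

section Preadditive

variable {C : Type u} [Category.{v} C] [Preadditive C]

theorem isIso_of_unipotent {X : C} (u : X ⟶ X) (h : (u - 𝟙 X) ≫ (u - 𝟙 X) = 0) : IsIso u := by
  have h' : u ≫ u = u + u - 𝟙 X := by
    simp only [Preadditive.sub_comp, Preadditive.comp_sub, Category.comp_id, Category.id_comp] at h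
    rw [← sub_eq_zero, ← h]; abel
  refine ⟨𝟙 X + 𝟙 X - u, ?_, ?_⟩
  · simp only [Preadditive.comp_sub, Preadditive.comp_add, Category.comp_id, h']; abel
  · simp only [Preadditive.sub_comp, Preadditive.add_comp, Category.id_comp, h']; abel

theorem isIso_of_isIso_comp_comp {D : Type u} [Category.{v} D] {X Y : D} (f : X ⟶ Y) (g : Y ⟶ X)
    (h₁ : IsIso (f ≫ g)) (h₂ : IsIso (g ≫ f)) : IsIso f := by
  have e : f ≫ (g ≫ inv (f ≫ g)) = 𝟙 X := by rw [← Category.assoc]; simp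
  have e' : (inv (g ≫ f) ≫ g) ≫ f = 𝟙 Y := by simp
  refine ⟨g ≫ inv (f ≫ g), e, ?_⟩
  have : g ≫ inv (f ≫ g) = inv (g ≫ f) ≫ g := by
    calc g ≫ inv (f ≫ g) = ((inv (g ≫ f) ≫ g) ≫ f) ≫ (g ≫ inv (f ≫ g)) := by
          rw [e', Category.id_comp]
      _ = (inv (g ≫ f) ≫ g) ≫ (f ≫ (g ≫ inv (f ≫ g))) := Category.assoc _ _ _
      _ = _ := by rw [e, Category.comp_id]
  rw [this, e']

end Preadditive

/-! ### Functoriality of the extension groups -/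

section Ext

variable {C : Type u} [Category.{v} C] (E : Cᵒᵖ ⥤ C ⥤ AddCommGrpCat.{w})

@[simp] theorem extPush_id {X A : C} (δ : ExtGroup E X A) : extPush E (𝟙 A) δ = δ := by
  simp [extPush]

@[simp] theorem extPull_id {X A : C} (δ : ExtGroup E X A) : extPull E (𝟙 X) δ = δ := by
  simp [extPull]

theorem extPush_comp {X A A' A'' : C} (a : A ⟶ A') (a' : A' ⟶ A'') (δ : ExtGroup E X A) :
    extPush E (a ≫ a') δ = extPush E a' (extPush E a δ) := by
  simp [extPush]

theorem extPull_comp {X X' X'' A : C} (c : X' ⟶ X) (c' : X'' ⟶ X') (δ : ExtGroup E X A) :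
    extPull E (c' ≫ c) δ = extPull E c' (extPull E c δ) := by
  simp [extPull]

theorem extPush_extPull {X X' A A' : C} (a : A ⟶ A') (c : X' ⟶ X) (δ : ExtGroup E X A) :
    extPush E a (extPull E c δ) = extPull E c (extPush E a δ) := by
  simp [extPush, extPull]

@[simp] theorem extPush_zero {X A A' : C} (a : A ⟶ A') :
    extPush E a (0 : ExtGroup E X A) = 0 := map_zero _

@[simp] theorem extPull_zero {X X' A : C} (c : X' ⟶ X) :
    extPull E c (0 : ExtGroup E X A) = 0 := map_zero _

end Ext

/-! ### Exact sequences and comparison of `E`-triangles -/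

namespace ExtriangulatedStructure

section Exactness

variable {C : Type u} [Category.{v} C] [Preadditive C] [HasBinaryBiproducts C]
  (T : ExtriangulatedStructure.{w} C)

theorem extPush_sub {X A A' : C} (a a' : A ⟶ A') (δ : ExtGroup T.E X A) :
    extPush T.E (a - a') δ = extPush T.E a δ - extPush T.E a' δ := by
  have := T.additive_right (op X)
  simp [extPush, Functor.map_sub]

theorem extPull_sub {X X' A : C} (c c' : X' ⟶ X) (δ : ExtGroup T.E X A) :
    extPull T.E (c - c') δ = extPull T.E c δ - extPull T.E c' δ := by
  have := T.additive_left A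
  have h : (T.E.flip.obj A).map (c - c').op
      = (T.E.flip.obj A).map c.op - (T.E.flip.obj A).map c'.op := by
    rw [← Functor.map_sub]; rfl
  have := congrArg (fun f => AddCommGrpCat.Hom.hom f δ) h
  simpa [extPull] using! this

theorem realizes_id_left {Z : C} (hZ : IsZero Z) (D : C) :
    T.Realizes (0 : ExtGroup T.E D Z) (0 : Z ⟶ D) (𝟙 D) := by
  let e : Z ⊞ D ≅ D := ⟨biprod.snd, biprod.inr, by
    ext
    · exact hZ.eq_of_src _ _
    · exact hZ.eq_of_src _ _
    · simp
    · simp, by simp⟩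
  have := T.realization_closed _ _ _ e (T.realizes_zero Z D)
  simpa [e] using this

theorem realizes_id_right {Z : C} (hZ : IsZero Z) (D : C) :
    T.Realizes (0 : ExtGroup T.E Z D) (𝟙 D) (0 : D ⟶ Z) := by
  let e : D ⊞ Z ≅ D := ⟨biprod.fst, biprod.inl, by
    ext
    · simp
    · simp
    · exact hZ.eq_of_src _ _
    · exact hZ.eq_of_src _ _, by simp⟩
  have := T.realization_closed _ _ _ e (T.realizes_zero D Z)
  simpa [e] using this

variable {T}

theorem isTriangle_biprod (A X : C) :
    T.IsTriangle (biprod.inl : A ⟶ A ⊞ X) (biprod.snd : A ⊞ X ⟶ X) := ⟨0, T.realizes_zero A X⟩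

theorem IsTriangle.biprod_map {A B X A' B' X' : C} {x : A ⟶ B} {y : B ⟶ X} (h : T.IsTriangle x y)
    {x' : A' ⟶ B'} {y' : B' ⟶ X'} (h' : T.IsTriangle x' y') :
    T.IsTriangle (biprod.map x x') (biprod.map y y') :=
  ⟨_, T.realizes_sum _ _ _ _ _ _ h.choose_spec h'.choose_spec⟩

theorem IsTriangle.comp_inflation {A B X D F : C} {f : A ⟶ B} {f' : B ⟶ D} {g : B ⟶ X}
    {g' : X ⟶ F} (h : T.IsTriangle f f') (h' : T.IsTriangle g g') :
    ∃ (G : C) (q : X ⟶ G) (d : D ⟶ G) (e : G ⟶ F), T.IsTriangle (f ≫ g) q ∧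
      T.IsTriangle d e := by
  obtain ⟨δ, h⟩ := h
  obtain ⟨δ', h'⟩ := h'
  obtain ⟨G, q, d, e, δ'', h1, -, -, h2, -⟩ := T.et4 _ _ _ _ _ _ h h'
  exact ⟨G, q, d, e, ⟨_, h1⟩, ⟨_, h2⟩⟩

theorem IsTriangle.comp_deflation {A B X D F : C} {f' : D ⟶ A} {f : A ⟶ B} {g' : F ⟶ B}
    {g : B ⟶ X} (h : T.IsTriangle f' f) (h' : T.IsTriangle g' g) :
    ∃ (G : C) (j : G ⟶ A) (d : D ⟶ G) (e : G ⟶ F), T.IsTriangle j (f ≫ g) ∧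
      T.IsTriangle d e := by
  obtain ⟨δ, h⟩ := h
  obtain ⟨δ', h'⟩ := h'
  obtain ⟨G, q, d, e, δ'', h1, -, -, h2, -⟩ := T.et4_op _ _ _ _ _ _ h h'
  exact ⟨G, q, d, e, ⟨_, h1⟩, ⟨_, h2⟩⟩

variable [HasZeroObject C]

open ZeroObject

/-- Exactness at the middle term, covariantly. -/
theorem Realizes.exists_desc {A B X D : C} {δ : ExtGroup T.E X A} {x : A ⟶ B} {y : B ⟶ X}
    (h : T.Realizes δ x y) (k : B ⟶ D) (hk : x ≫ k = 0) : ∃ g : X ⟶ D, y ≫ g = k := by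
  -- (ET3) is applied to a map into the split triangle `0 → D → D`; its third component is the
  -- factorization.
  obtain ⟨c, hc, -⟩ := T.et3 _ _ _ _ _ _ h (T.realizes_id_left (isZero_zero C) D) 0 k (by simp [hk])
  exact ⟨c, by simpa using hc⟩

/-- Exactness at the middle term, contravariantly. -/
theorem Realizes.exists_lift {A B X D : C} {δ : ExtGroup T.E X A} {x : A ⟶ B} {y : B ⟶ X}
    (h : T.Realizes δ x y) (k : D ⟶ B) (hk : k ≫ y = 0) : ∃ g : D ⟶ A, g ≫ x = k := by
  obtain ⟨c, hc, -⟩ :=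
    T.et3_op _ _ _ _ _ _ (T.realizes_id_right (isZero_zero C) D) h k 0 (by simp [hk])
  exact ⟨c, by simpa using hc.symm⟩

theorem Realizes.exists_extend_iff {A B X D : C} {δ : ExtGroup T.E X A} {x : A ⟶ B} {y : B ⟶ X}
    (h : T.Realizes δ x y) (a : A ⟶ D) : (∃ b : B ⟶ D, x ≫ b = a) ↔ extPush T.E a δ = 0 := by
  constructor
  · rintro ⟨b, hb⟩
    obtain ⟨c, -, hc⟩ :=
      T.et3 _ _ _ _ _ _ h (T.realizes_id_right (isZero_zero C) D) a b (by simp [hb])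
    simpa using hc
  · intro ha
    obtain ⟨b, hb, -⟩ := T.realization_map _ _ _ _ _ _ h (T.realizes_zero D X) a (𝟙 X) (by simp [ha])
    exact ⟨b ≫ biprod.fst, by rw [← Category.assoc, hb]; simp⟩

theorem Realizes.exists_factor_iff {A B X D : C} {δ : ExtGroup T.E X A} {x : A ⟶ B} {y : B ⟶ X}
    (h : T.Realizes δ x y) (c : D ⟶ X) : (∃ b : D ⟶ B, b ≫ y = c) ↔ extPull T.E c δ = 0 := by
  constructor
  · rintro ⟨b, hb⟩
    obtain ⟨a, -, ha⟩ :=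
      T.et3_op _ _ _ _ _ _ (T.realizes_id_left (isZero_zero C) D) h b c (by simp [hb])
    simpa using ha.symm
  · intro hc
    obtain ⟨b, -, hb⟩ := T.realization_map _ _ _ _ _ _ (T.realizes_zero A D) h (𝟙 A) c (by simp [hc])
    exact ⟨biprod.inr ≫ b, by rw [Category.assoc, ← hb]; simp⟩

/-- Exactness at `E(X, D)` of the contravariant sequence. -/
theorem Realizes.exists_push_of_pull_eq_zero {A B X D : C} {δ : ExtGroup T.E X A} {x : A ⟶ B}
    {y : B ⟶ X} (h : T.Realizes δ x y) (ε : ExtGroup T.E X D) (hε : extPull T.E y ε = 0) :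
    ∃ a : A ⟶ D, extPush T.E a δ = ε := by
  obtain ⟨F, p, q, hF⟩ := T.exists_realization ε
  obtain ⟨b, hb⟩ := (hF.exists_factor_iff y).2 hε
  obtain ⟨a, -, ha⟩ := T.et3_op _ _ _ _ _ _ h hF b (𝟙 X) (by simp [hb])
  exact ⟨a, by simpa using ha⟩

/-- Exactness at `E(D, A)` of the covariant sequence. -/
theorem Realizes.exists_pull_of_push_eq_zero {A B X D : C} {δ : ExtGroup T.E X A} {x : A ⟶ B}
    {y : B ⟶ X} (h : T.Realizes δ x y) (ε : ExtGroup T.E D A) (hε : extPush T.E x ε = 0) :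
    ∃ c : D ⟶ X, extPull T.E c δ = ε := by
  obtain ⟨F, p, q, hF⟩ := T.exists_realization ε
  obtain ⟨b, hb⟩ := (hF.exists_extend_iff x).2 hε
  obtain ⟨c, -, hc⟩ := T.et3 _ _ _ _ _ _ hF h (𝟙 A) b (by simp [hb])
  exact ⟨c, by simpa using hc.symm⟩

/-- Exactness at `E(D, B)` of the covariant sequence. -/
theorem Realizes.exists_push_eq {A B X D : C} {δ : ExtGroup T.E X A} {x : A ⟶ B}
    {y : B ⟶ X} (h : T.Realizes δ x y) (ε : ExtGroup T.E D B) (hε : extPush T.E y ε = 0) :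
    ∃ ε' : ExtGroup T.E D A, extPush T.E x ε' = ε := by
  obtain ⟨F, p, q, hF⟩ := T.exists_realization ε
  -- For the composite inflation `A → B → F`, (ET4) gives a triangle `X → G → D` that realizes `y_*
  -- ε = 0` and so splits; pulling `δ''` back along a section gives the preimage of `ε`.
  obtain ⟨G, h', d, e, δ'', -, -, -, hde, -, he⟩ := T.et4 _ _ _ _ _ _ h hF
  obtain ⟨s, hs⟩ := (hde.exists_factor_iff (𝟙 D)).2 (by simpa using hε)
  refine ⟨extPull T.E s δ'', ?_⟩
  rw [extPush_extPull, he, ← extPull_comp, hs, extPull_id]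

/-- Exactness at `E(B, D)` of the contravariant sequence. -/
theorem Realizes.exists_pull_eq {A B X D : C} {δ : ExtGroup T.E X A} {x : A ⟶ B}
    {y : B ⟶ X} (h : T.Realizes δ x y) (ε : ExtGroup T.E B D) (hε : extPull T.E x ε = 0) :
    ∃ ε' : ExtGroup T.E X D, extPull T.E y ε' = ε := by
  obtain ⟨F, p, q, hF⟩ := T.exists_realization ε
  obtain ⟨G, h', d, e, δ'', -, -, -, hde, -, he⟩ := T.et4_op _ _ _ _ _ _ hF h
  obtain ⟨s, hs⟩ := (hde.exists_extend_iff (𝟙 D)).2 (by simpa using hε)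
  refine ⟨extPush T.E s δ'', ?_⟩
  rw [← extPush_extPull, ← he, ← extPush_comp, hs, extPush_id]

/-- The difference `b - 1` vanishes after `x`, so it factors through `y`, and it vanishes before
`y`; hence its square is zero. The analogues for the end terms use the extension class to obtain the
factorization. -/
theorem Realizes.isIso_middle_endo {A B X : C} {δ : ExtGroup T.E X A} {x : A ⟶ B} {y : B ⟶ X}
    (h : T.Realizes δ x y) (b : B ⟶ B) (hx : x ≫ b = x) (hy : b ≫ y = y) : IsIso b := by
  apply isIso_of_unipotent
  obtain ⟨g, hg⟩ := h.exists_desc (b - 𝟙 B) (by simp [hx])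
  have h1 : (b - 𝟙 B) ≫ y = 0 := by simp [hy]
  calc (b - 𝟙 B) ≫ (b - 𝟙 B) = ((b - 𝟙 B) ≫ y) ≫ g := by rw [Category.assoc, hg]
    _ = 0 := by rw [h1, zero_comp]

theorem Realizes.isIso_left_endo {A B X : C} {δ : ExtGroup T.E X A} {x : A ⟶ B} {y : B ⟶ X}
    (h : T.Realizes δ x y) (a : A ⟶ A) (hx : a ≫ x = x) (ha : extPush T.E a δ = δ) : IsIso a := by
  apply isIso_of_unipotent
  obtain ⟨g, hg⟩ := (h.exists_extend_iff (a - 𝟙 A)).2 (by simp [extPush_sub, ha])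
  have h1 : (a - 𝟙 A) ≫ x = 0 := by simp [hx]
  calc (a - 𝟙 A) ≫ (a - 𝟙 A) = ((a - 𝟙 A) ≫ x) ≫ g := by rw [Category.assoc, hg]
    _ = 0 := by rw [h1, zero_comp]

theorem Realizes.isIso_right_endo {A B X : C} {δ : ExtGroup T.E X A} {x : A ⟶ B} {y : B ⟶ X}
    (h : T.Realizes δ x y) (c : X ⟶ X) (hy : y ≫ c = y) (hc : extPull T.E c δ = δ) : IsIso c := by
  apply isIso_of_unipotent
  obtain ⟨g, hg⟩ := (h.exists_factor_iff (c - 𝟙 X)).2 (by simp [extPull_sub, hc])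
  have h1 : y ≫ (c - 𝟙 X) = 0 := by simp [hy]
  calc (c - 𝟙 X) ≫ (c - 𝟙 X) = g ≫ (y ≫ (c - 𝟙 X)) := by rw [← Category.assoc, hg]
    _ = 0 := by rw [h1, comp_zero]

/-- Transport of a realization along isomorphisms of the end terms. -/
theorem Realizes.of_iso_ends {A B X A' X' : C} {δ : ExtGroup T.E X A} {x : A ⟶ B} {y : B ⟶ X}
    (h : T.Realizes δ x y) (a : A ≅ A') (c : X ≅ X') :
    T.Realizes (extPush T.E a.hom (extPull T.E c.inv δ)) (a.inv ≫ x) (y ≫ c.hom) := by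
  -- A realization of the transported class is compared with the given sequence in both directions;
  -- both composites are endomorphisms that fix the ends, hence isomorphisms.
  obtain ⟨B', x', y', h'⟩ := T.exists_realization (extPush T.E a.hom (extPull T.E c.inv δ))
  obtain ⟨b, hb₁, hb₂⟩ := T.realization_map _ _ _ _ _ _ h h' a.hom c.hom
    (by rw [← extPush_extPull, ← extPull_comp]; simp)
  obtain ⟨b', hb₁', hb₂'⟩ := T.realization_map _ _ _ _ _ _ h' h a.inv c.inv
    (by rw [← extPush_comp]; simp)
  have i1 : IsIso (b ≫ b') := h.isIso_middle_endo _
    (by rw [← Category.assoc, hb₁, Category.assoc, hb₁', Iso.hom_inv_id_assoc])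
    (by rw [Category.assoc, ← hb₂', ← Category.assoc, ← hb₂, Category.assoc, Iso.hom_inv_id,
      Category.comp_id])
  have i2 : IsIso (b' ≫ b) := h'.isIso_middle_endo _
    (by rw [← Category.assoc, hb₁', Category.assoc, hb₁, Iso.inv_hom_id_assoc])
    (by rw [Category.assoc, ← hb₂, ← Category.assoc, ← hb₂', Category.assoc, Iso.inv_hom_id,
      Category.comp_id])
  have := isIso_of_isIso_comp_comp b b' i1 i2
  have key := T.realization_closed _ _ _ (asIso b).symm h'
  have e1 : x' ≫ inv b = a.inv ≫ x := by
    rw [IsIso.comp_inv_eq, Category.assoc, hb₁, Iso.inv_hom_id_assoc]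
  simpa [e1, ← hb₂] using key

theorem IsTriangle.of_iso {A B X A' B' X' : C} {x : A ⟶ B} {y : B ⟶ X} (h : T.IsTriangle x y)
    (a : A ≅ A') (b : B ≅ B') (c : X ≅ X') {x' : A' ⟶ B'} {y' : B' ⟶ X'}
    (hx : a.inv ≫ x ≫ b.hom = x') (hy : b.inv ≫ y ≫ c.hom = y') : T.IsTriangle x' y' := by
  obtain ⟨δ, h⟩ := h
  have := T.realization_closed _ _ _ b (h.of_iso_ends a c)
  subst hx hy
  exact ⟨_, by simpa using this⟩

theorem IsTriangle.exists_desc {A B X D : C} {x : A ⟶ B} {y : B ⟶ X} (h : T.IsTriangle x y)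
    (k : B ⟶ D) (hk : x ≫ k = 0) : ∃ g : X ⟶ D, y ≫ g = k := h.choose_spec.exists_desc k hk

theorem IsTriangle.exists_lift {A B X D : C} {x : A ⟶ B} {y : B ⟶ X} (h : T.IsTriangle x y)
    (k : D ⟶ B) (hk : k ≫ y = 0) : ∃ g : D ⟶ A, g ≫ x = k := h.choose_spec.exists_lift k hk

theorem IsTriangle.exists_extend {A B X D : C} {x : A ⟶ B} {y : B ⟶ X} (h : T.IsTriangle x y)
    (hE : ∀ ε : ExtGroup T.E X D, ε = 0) (a : A ⟶ D) : ∃ b : B ⟶ D, x ≫ b = a :=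
  (h.choose_spec.exists_extend_iff a).2 (hE _)

theorem IsTriangle.exists_factor {A B X D : C} {x : A ⟶ B} {y : B ⟶ X} (h : T.IsTriangle x y)
    (hE : ∀ ε : ExtGroup T.E D A, ε = 0) (c : D ⟶ X) : ∃ b : D ⟶ B, b ≫ y = c :=
  (h.choose_spec.exists_factor_iff c).2 (hE _)

/-- Extensions vanish on the middle term if they vanish on the outer terms. -/
theorem IsTriangle.ext_middle_right {A B X D : C} {x : A ⟶ B} {y : B ⟶ X} (h : T.IsTriangle x y)
    (hA : ∀ ε : ExtGroup T.E D A, ε = 0) (hX : ∀ ε : ExtGroup T.E D X, ε = 0)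
    (ε : ExtGroup T.E D B) : ε = 0 := by
  obtain ⟨δ, h⟩ := h
  obtain ⟨ε', rfl⟩ := h.exists_push_eq ε (hX _)
  rw [hA ε', extPush_zero]

theorem IsTriangle.ext_middle_left {A B X D : C} {x : A ⟶ B} {y : B ⟶ X} (h : T.IsTriangle x y)
    (hA : ∀ ε : ExtGroup T.E A D, ε = 0) (hX : ∀ ε : ExtGroup T.E X D, ε = 0)
    (ε : ExtGroup T.E B D) : ε = 0 := by
  obtain ⟨δ, h⟩ := h
  obtain ⟨ε', rfl⟩ := h.exists_pull_eq ε (hA _)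
  rw [hX ε', extPull_zero]

/-- Two fibres of the same deflation are isomorphic. -/
theorem IsTriangle.exists_fiberIso {A A' B B' X : C} {x : A ⟶ B} {y : B ⟶ X} {x' : A' ⟶ B'}
    {y' : B' ⟶ X} (h : T.IsTriangle x y) (h' : T.IsTriangle x' y') (b : B ≅ B')
    (hb : b.hom ≫ y' = y) : ∃ a : A ≅ A', a.hom ≫ x' = x ≫ b.hom := by
  obtain ⟨δ, h⟩ := h
  obtain ⟨δ', h'⟩ := h'
  obtain ⟨a, ha, ha'⟩ := T.et3_op _ _ _ _ _ _ h h' b.hom (𝟙 X) (by simp [hb])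
  obtain ⟨c, hc, hc'⟩ := T.et3_op _ _ _ _ _ _ h' h b.inv (𝟙 X) (by simp [← hb])
  simp only [extPull_id] at ha' hc'
  have i1 : IsIso (a ≫ c) := h.isIso_left_endo _
    (by rw [Category.assoc, ← hc, ← Category.assoc, ← ha]; simp) (by rw [extPush_comp, ha', hc'])
  have i2 : IsIso (c ≫ a) := h'.isIso_left_endo _
    (by rw [Category.assoc, ← ha, ← Category.assoc, ← hc]; simp) (by rw [extPush_comp, hc', ha'])
  have := isIso_of_isIso_comp_comp a c i1 i2
  exact ⟨asIso a, ha.symm⟩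

/-- An `E`-triangle with zero extension is split. -/
theorem IsTriangle.exists_iso_biprod {A B X : C} {x : A ⟶ B} {y : B ⟶ X} (h : T.IsTriangle x y)
    (hy : ∃ s : X ⟶ B, s ≫ y = 𝟙 X) :
    ∃ e : B ≅ A ⊞ X, x ≫ e.hom = biprod.inl ∧ e.hom ≫ biprod.snd = y := by
  obtain ⟨δ, h⟩ := h
  have h0 : δ = 0 := by simpa using (h.exists_factor_iff (𝟙 X)).1 hy
  subst h0
  exact T.realization_unique _ _ _ _ _ h (T.realizes_zero A X)

theorem ext_eq_zero_of_isProjectiveObj {P D : C} (hP : T.IsProjectiveObj P)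
    (ε : ExtGroup T.E P D) : ε = 0 := by
  obtain ⟨F, p, q, hF⟩ := T.exists_realization ε
  simpa using (hF.exists_factor_iff (𝟙 P)).1 (hP p q ⟨_, hF⟩ (𝟙 P))

end Exactness

end ExtriangulatedStructure

/-! ### Homotopy pushouts and pullbacks -/

namespace ExtriangulatedStructure

section Squares

variable {C : Type u} [Category.{v} C] [Preadditive C] [HasBinaryBiproducts C] [HasZeroObject C]
  {T : ExtriangulatedStructure.{w} C}

open ZeroObject

/-- The projection `0 ⊞ X ≅ X`. -/
noncomputable def zeroBiprodIso (X : C) : (0 : C) ⊞ X ≅ X where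
  hom := biprod.snd
  inv := biprod.inr
  hom_inv_id := biprod.hom_ext' _ _ ((isZero_zero C).eq_of_src _ _) (by simp)

/-- Multiplication by `-1`. -/
def negIso (X : C) : X ≅ X := ⟨-𝟙 X, -𝟙 X, by simp, by simp⟩

/-- The homotopy pushout of an inflation. -/
theorem Realizes.exists_pushout {A B X D : C} {δ : ExtGroup T.E X A} {x : A ⟶ B} {y : B ⟶ X}
    (h : T.Realizes δ x y) (a : A ⟶ D) :
    ∃ (G : C) (d : D ⟶ G) (e : G ⟶ X) (b : B ⟶ G), T.Realizes (extPush T.E a δ) d e ∧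
      b ≫ e = y ∧ T.IsTriangle (biprod.lift (-a) x) (biprod.desc d b) := by
  -- (ET4) is applied to `A → D ⊞ A → D ⊞ B`: the first inflation is the graph of `-a`, with cone
  -- `D`, and the second is `1 ⊞ x`, with cone `X`.
  have h₁ := (T.realizes_sum _ _ _ _ _ _ (T.realizes_id_right (isZero_zero C) D) h).of_iso_ends
    (Iso.refl _) (zeroBiprodIso X)
  have h₂ : T.IsTriangle (biprod.lift (-a) (𝟙 A)) (biprod.desc (𝟙 D) a) := by
    let b : A ⊞ D ≅ D ⊞ A :=
      { hom := biprod.desc (biprod.lift (-a) (𝟙 A)) biprod.inl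
        inv := biprod.lift biprod.snd (biprod.desc (𝟙 D) a)
        hom_inv_id := by ext <;> simp
        inv_hom_id := by ext <;> simp }
    refine (isTriangle_biprod A D).of_iso (Iso.refl A) b (Iso.refl D) ?_ ?_
    · simp [b]
    · simp [b]
  obtain ⟨δ₂, h₂⟩ := h₂
  obtain ⟨G, h', d, e, δ'', H, h₃, h₄, h₅, -⟩ := T.et4 _ _ _ _ _ _ h₂ h₁
  have e₁ : biprod.inl ≫ h' = d := by
    have := biprod.inl ≫= h₃
    simpa using this.symm
  have e₂ : (biprod.inr ≫ h') ≫ e = y := by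
    rw [Category.assoc, h₄]; simp [zeroBiprodIso]
  refine ⟨G, d, e, biprod.inr ≫ h', ?_, e₂, δ'', ?_⟩
  · convert h₅ using 1
    simp only [zeroBiprodIso, extSum, extPush_zero, extPull_zero, zero_add, Iso.refl_hom,
      Category.comp_id, ← extPull_comp, ← extPush_comp, biprod.inr_snd, extPull_id,
      biprod.inr_desc]
  · convert H using 1
    · ext <;> simp
    · ext <;> simp [e₁]

/-- The homotopy pullback of a deflation. -/
theorem Realizes.exists_pullback {A B X D : C} {δ : ExtGroup T.E X A} {x : A ⟶ B} {y : B ⟶ X}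
    (h : T.Realizes δ x y) (c : D ⟶ X) :
    ∃ (G : C) (d : A ⟶ G) (e : G ⟶ D) (b : G ⟶ B), T.Realizes (extPull T.E c δ) d e ∧
      d ≫ b = x ∧ T.IsTriangle (biprod.lift e b) (biprod.desc (-c) y) := by
  have h₁ := (T.realizes_sum _ _ _ _ _ _ (T.realizes_id_left (isZero_zero C) D) h).of_iso_ends
    (zeroBiprodIso A) (Iso.refl _)
  have h₂ : T.IsTriangle (biprod.lift (𝟙 D) c) (biprod.desc (-c) (𝟙 X)) := by
    let b : D ⊞ X ≅ D ⊞ X :=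
      { hom := biprod.desc (biprod.lift (𝟙 D) c) biprod.inr
        inv := biprod.lift biprod.fst (biprod.desc (-c) (𝟙 X))
        hom_inv_id := by ext <;> simp
        inv_hom_id := by ext <;> simp }
    refine (isTriangle_biprod D X).of_iso (Iso.refl D) b (Iso.refl X) ?_ ?_
    · simp [b]
    · simp [b]
  obtain ⟨δ₂, h₂⟩ := h₂
  obtain ⟨G, h', d, e, δ'', H, h₃, h₄, h₅, -⟩ := T.et4_op _ _ _ _ _ _ h₁ h₂
  have e₁ : h' ≫ biprod.fst = e := by
    have := h₄ =≫ biprod.fst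
    simpa using this
  have e₂ : d ≫ h' ≫ biprod.snd = x := by
    rw [← Category.assoc, h₃]; simp [zeroBiprodIso]
  refine ⟨G, d, e, h' ≫ biprod.snd, ?_, e₂, δ'', ?_⟩
  · convert h₅ using 1
    simp only [zeroBiprodIso, extSum, extPush_zero, extPull_zero, zero_add, Iso.refl_inv,
      Category.id_comp, extPush_extPull, ← extPush_comp, biprod.inr_snd, extPush_id, ← extPull_comp,
      biprod.lift_snd]
  · convert H using 1
    · ext <;> simp [e₁]
    · ext <;> simp

/-- Two cones of the same inflation are isomorphic. -/
theorem IsTriangle.exists_coneIso {A B B' X X' : C} {x : A ⟶ B} {y : B ⟶ X} {x' : A ⟶ B'}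
    {y' : B' ⟶ X'} (h : T.IsTriangle x y) (h' : T.IsTriangle x' y') (b : B ≅ B')
    (hb : x ≫ b.hom = x') : ∃ c : X ≅ X', y ≫ c.hom = b.hom ≫ y' := by
  obtain ⟨δ, h⟩ := h
  obtain ⟨δ', h'⟩ := h'
  obtain ⟨a, ha, ha'⟩ := T.et3 _ _ _ _ _ _ h h' (𝟙 A) b.hom (by simp [hb])
  obtain ⟨c, hc, hc'⟩ := T.et3 _ _ _ _ _ _ h' h (𝟙 A) b.inv (by simp [← hb])
  simp only [extPush_id] at ha' hc'
  have i1 : IsIso (a ≫ c) := h.isIso_right_endo _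
    (by rw [← Category.assoc, ha, Category.assoc, hc]; simp) (by rw [extPull_comp, ← hc', ← ha'])
  have i2 : IsIso (c ≫ a) := h'.isIso_right_endo _
    (by rw [← Category.assoc, hc, Category.assoc, ha]; simp) (by rw [extPull_comp, ← ha', ← hc'])
  have := isIso_of_isIso_comp_comp a c i1 i2
  exact ⟨asIso a, ha⟩

/-- The pullback of two deflations. -/
theorem IsTriangle.exists_pullback {A B X U V : C} {x : A ⟶ B} {y : B ⟶ X} {i : V ⟶ U}
    {p : U ⟶ X} (h : T.IsTriangle x y) (h' : T.IsTriangle i p) :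
    ∃ (G : C) (d : A ⟶ G) (e : G ⟶ U) (j : V ⟶ G) (b : G ⟶ B), T.IsTriangle d e ∧
      T.IsTriangle j b ∧ d ≫ b = x := by
  obtain ⟨δ, h⟩ := h
  obtain ⟨δ', h'⟩ := h'
  obtain ⟨G, d, e, b, H₁, H₂, H₃⟩ := h.exists_pullback p
  obtain ⟨G', d', e', b', H₁', -, H₃'⟩ := h'.exists_pullback y
  -- Both homotopy pullbacks are fibres of the difference of `y` and `p`, with opposite signs; the
  -- negated swap matches them, and `negIso` removes the remaining sign on `B`.
  let θ : B ⊞ U ≅ U ⊞ B :=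
    { hom := biprod.desc (-biprod.inr) (-biprod.inl)
      inv := biprod.desc (-biprod.inr) (-biprod.inl)
      hom_inv_id := by ext <;> simp
      inv_hom_id := by ext <;> simp }
  obtain ⟨a, ha⟩ := H₃'.exists_fiberIso H₃ θ (by ext <;> simp [θ])
  have ha' : a.hom ≫ b = -e' := by
    have := ha =≫ biprod.snd
    simpa [θ, biprod.lift_eq] using this
  refine ⟨G, d, e, d' ≫ a.hom, b, ⟨_, H₁⟩, ?_, H₂⟩
  refine IsTriangle.of_iso ⟨_, H₁'⟩ (Iso.refl V) a (negIso B) (by simp) ?_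
  rw [Iso.inv_comp_eq, ha']
  simp [negIso]

/-- The pushout of two inflations. -/
theorem IsTriangle.exists_pushout {A B X U V : C} {x : A ⟶ B} {y : B ⟶ X} {i : A ⟶ V}
    {p : V ⟶ U} (h : T.IsTriangle x y) (h' : T.IsTriangle i p) :
    ∃ (G : C) (d : V ⟶ G) (e : G ⟶ X) (b : B ⟶ G) (q : G ⟶ U), T.IsTriangle d e ∧
      T.IsTriangle b q ∧ b ≫ e = y := by
  obtain ⟨δ, h⟩ := h
  obtain ⟨δ', h'⟩ := h'
  obtain ⟨G, d, e, b, H₁, H₂, H₃⟩ := h.exists_pushout i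
  obtain ⟨G', d', e', b', H₁', -, H₃'⟩ := h'.exists_pushout x
  let θ : B ⊞ V ≅ V ⊞ B :=
    { hom := biprod.desc (-biprod.inr) (-biprod.inl)
      inv := biprod.desc (-biprod.inr) (-biprod.inl)
      hom_inv_id := by ext <;> simp
      inv_hom_id := by ext <;> simp }
  obtain ⟨a, ha⟩ := H₃'.exists_coneIso H₃ θ (by ext <;> simp [θ, biprod.lift_eq])
  have ha' : d' ≫ a.hom = -b := by
    have := biprod.inl ≫= ha
    simpa [θ] using this
  refine ⟨G, d, e, b, a.inv ≫ e', ⟨_, H₁⟩, ?_, H₂⟩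
  refine IsTriangle.of_iso ⟨_, H₁'⟩ (negIso B) a (Iso.refl U) ?_ (by simp)
  rw [ha']
  simp [negIso]

/-- The homotopy pushout of an inflation along a deflation. -/
theorem IsTriangle.exists_pushout_deflation {A B X U V : C} {i : V ⟶ A} {a : A ⟶ X} {x : A ⟶ B}
    {y : B ⟶ U} (h : T.IsTriangle i a) (h' : T.IsTriangle x y) :
    ∃ (G : C) (q : B ⟶ G) (r : X ⊞ B ⟶ G), T.IsTriangle (i ≫ x) q ∧
      T.IsTriangle (biprod.lift (-a) x) r := by
  obtain ⟨δ, h⟩ := h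
  obtain ⟨δ', h'⟩ := h'
  obtain ⟨G, q, d, e, δ'', H, -, -, H', -⟩ := T.et4 _ _ _ _ _ _ h h'
  obtain ⟨G', d', e', b, K, -, K'⟩ := h'.exists_pushout a
  -- The octahedron and the homotopy pushout both realize `a_* δ'`, so their middle terms agree.
  obtain ⟨φ, -⟩ := T.realization_unique _ _ _ _ _ K H'
  exact ⟨G, q, biprod.desc d' b ≫ φ.hom, ⟨_, H⟩,
    K'.of_iso (Iso.refl _) (Iso.refl _) φ (by simp) (by simp)⟩

end Squares

end ExtriangulatedStructure

/-! ### Cotorsion pairs, perpendicular and thick subcategories -/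

theorem IsAdditiveSubcategory.summand_right {C : Type u} [Category.{v} C] [Preadditive C]
    [HasBinaryBiproducts C] {P : ObjectProperty C} (hP : IsAdditiveSubcategory P) {X Y : C}
    (h : P (X ⊞ Y)) : P Y :=
  hP.summand (hP.of_iso (biprod.braiding X Y) h)

namespace ExtriangulatedStructure

section Subcategories

variable {C : Type u} [Category.{v} C] [Preadditive C] [HasBinaryBiproducts C]
  {T : ExtriangulatedStructure.{w} C} {W : ObjectProperty C}

theorem IsCotorsionPair.mem_right {P Q : ObjectProperty C} (h : T.IsCotorsionPair P Q) {Y : C}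
    (hY : ∀ X, P X → ∀ ε : ExtGroup T.E X Y, ε = 0) : Q Y := by
  obtain ⟨A, B, x, y, hA, hB, δ, hxy⟩ := h.mem_cocone Y
  obtain rfl : δ = 0 := hY B hB δ
  obtain ⟨e, -⟩ := T.realization_unique _ _ _ _ _ hxy (T.realizes_zero Y B)
  exact h.right.summand (h.right.of_iso e hA)

theorem le_rightPerp (hW : T.IsPresilting W) : W ≤ T.rightPerp W :=
  fun S' hS' S hS => hW.2 S S' hS hS'

theorem le_leftPerp (hW : T.IsPresilting W) : W ≤ T.leftPerp W :=
  fun S hS S' hS' => hW.2 S S' hS hS'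

theorem le_vee : W ≤ T.vee W := fun _ h => ⟨0, h⟩

theorem le_thick : W ≤ T.thick W := fun _ h _ _ hQ => hQ _ h

theorem thick_isThick : T.IsThick (T.thick W) where
  additive :=
    { of_iso := fun e h Q hQ hWQ => hQ.additive.of_iso e (h Q hQ hWQ)
      of_isZero := fun h _ hQ _ => hQ.additive.of_isZero h
      biprod := fun h h' Q hQ hWQ => hQ.additive.biprod (h Q hQ hWQ) (h' Q hQ hWQ)
      summand := fun h Q hQ hWQ => hQ.additive.summand (h Q hQ hWQ) }
  mem₁ x y h hB hX Q hQ hWQ := hQ.mem₁ x y h (hB Q hQ hWQ) (hX Q hQ hWQ)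
  mem₂ x y h hB hX Q hQ hWQ := hQ.mem₂ x y h (hB Q hQ hWQ) (hX Q hQ hWQ)
  mem₃ x y h hB hX Q hQ hWQ := hQ.mem₃ x y h (hB Q hQ hWQ) (hX Q hQ hWQ)

theorem wedge_le_thick : T.wedge W ≤ T.thick W := by
  rintro X ⟨n, hn⟩
  induction n generalizing X with
  | zero => exact le_thick X hn
  | succ n ih =>
    obtain ⟨A, B, x, y, hA, hB, hxy⟩ := hn
    exact thick_isThick.mem₃ x y hxy (ih A hA) (le_thick B hB)

theorem vee_le_thick : T.vee W ≤ T.thick W := by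
  rintro X ⟨n, hn⟩
  induction n generalizing X with
  | zero => exact le_thick X hn
  | succ n ih =>
    obtain ⟨A, B, x, y, hA, hB, hxy⟩ := hn
    exact thick_isThick.mem₁ x y hxy (le_thick A hA) (ih B hB)

variable [HasZeroObject C]

/-- By (WIC) the retraction is a deflation because the identity is; its `E`-triangle then splits. -/
theorem exists_complement_of_retract (hWIC : T.WIC) {X Y : C} (m : X ⟶ Y) (p : Y ⟶ X)
    (h : m ≫ p = 𝟙 X) : ∃ (K : C) (e : Y ≅ K ⊞ X), e.hom ≫ biprod.snd = p := by
  obtain ⟨K, i, hi⟩ := (hWIC m p).2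
    (by rw [h]; exact ⟨_, _, _, T.realizes_id_left (isZero_zero C) X⟩)
  obtain ⟨e, -, he⟩ := hi.exists_iso_biprod ⟨m, h⟩
  exact ⟨K, e, he⟩

theorem mem_of_retract (hWIC : T.WIC) {P : ObjectProperty C} (hP : IsAdditiveSubcategory P)
    {X Y : C} (m : X ⟶ Y) (p : Y ⟶ X) (h : m ≫ p = 𝟙 X) (hY : P Y) : P X := by
  obtain ⟨K, e, -⟩ := exists_complement_of_retract hWIC m p h
  exact hP.summand_right (hP.of_iso e hY)

theorem IsCotorsionPair.mem_left {P Q : ObjectProperty C} (h : T.IsCotorsionPair P Q) {X : C}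
    (hX : ∀ Y, Q Y → ∀ ε : ExtGroup T.E X Y, ε = 0) : P X := by
  obtain ⟨A, B, x, y, hA, hB, hxy⟩ := h.mem_cone X
  obtain ⟨e, -⟩ := hxy.exists_iso_biprod (hxy.exists_factor (hX A hA) (𝟙 X))
  exact h.left.summand_right (h.left.of_iso e hB)

theorem IsCotorsionPair.ext_closed_left {P Q : ObjectProperty C} (h : T.IsCotorsionPair P Q)
    {A B X : C} {x : A ⟶ B} {y : B ⟶ X} (hxy : T.IsTriangle x y) (hA : P A) (hX : P X) : P B :=
  h.mem_left fun Y hY =>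
    hxy.ext_middle_left (h.ext_eq_zero A Y hA hY) (h.ext_eq_zero X Y hX hY)

theorem IsCotorsionPair.ext_closed_right {P Q : ObjectProperty C} (h : T.IsCotorsionPair P Q)
    {A B X : C} {x : A ⟶ B} {y : B ⟶ X} (hxy : T.IsTriangle x y) (hA : Q A) (hX : Q X) : Q B :=
  h.mem_right fun Y hY =>
    hxy.ext_middle_right (h.ext_eq_zero Y A hY hA) (h.ext_eq_zero Y X hY hX)

theorem rightPerp_middle {A B X : C} {x : A ⟶ B} {y : B ⟶ X} (hxy : T.IsTriangle x y)
    (hA : T.rightPerp W A) (hX : T.rightPerp W X) : T.rightPerp W B :=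
  fun S hS n K hK => hxy.ext_middle_right (hA S hS n K hK) (hX S hS n K hK)

/-- Dimension shift: a class in `E(K, X)` comes from a map `K' → X` on the next syzygy, this map
lifts to `B` because `E(K', A) = 0`, and so the class comes from `E(K, B) = 0`. -/
theorem rightPerp_cone (hProj : T.HasEnoughProjectives) {A B X : C} {x : A ⟶ B} {y : B ⟶ X}
    (hxy : T.IsTriangle x y) (hA : T.rightPerp W A) (hB : T.rightPerp W B) : T.rightPerp W X := by
  intro S hS n K hK ε
  obtain ⟨K', P, i, p, hP, hip⟩ := hProj K
  have hK' := IsSyzygy.succ i p hK hP hip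
  obtain ⟨δ, hδ⟩ := id hip
  obtain ⟨a, rfl⟩ := hδ.exists_push_of_pull_eq_zero ε (ext_eq_zero_of_isProjectiveObj hP _)
  obtain ⟨b, rfl⟩ := hxy.exists_factor (hA S hS _ K' hK') a
  rw [extPush_comp, hB S hS n K hK (extPush T.E b δ), extPush_zero]

theorem wedge_le_rightPerp (hProj : T.HasEnoughProjectives) (hW : T.IsPresilting W) :
    T.wedge W ≤ T.rightPerp W := by
  rintro X ⟨n, hn⟩
  induction n generalizing X with
  | zero => exact le_rightPerp hW X hn
  | succ n ih =>
    obtain ⟨A, B, x, y, hA, hB, hxy⟩ := hn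
    exact rightPerp_cone hProj hxy (ih A hA) (le_rightPerp hW B hB)

/-- Only the last step `A → B → V` of the resolution matters: `E(Z, A) = 0` lifts the map to `B`,
which lies in `W`. -/
theorem factorsThroughObj_of_wedge (hCP : T.CP W) {Z V : C} (hZ : T.leftPerp W Z)
    (hV : T.wedge W V) (f : Z ⟶ V) : FactorsThroughObj W f := by
  obtain ⟨n | n, hn⟩ := hV
  · exact ⟨V, f, 𝟙 V, hn, by simp⟩
  · obtain ⟨A, B, x, y, hA, hB, hxy⟩ := hn
    obtain ⟨g, hg⟩ := hxy.exists_factor (hCP.2.ext_eq_zero Z A hZ ⟨n, hA⟩) f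
    exact ⟨B, g, y, hB, hg⟩

theorem factorsThroughObj_of_vee (hCP : T.CP W) {U Y : C} (hU : T.vee W U)
    (hY : T.rightPerp W Y) (f : U ⟶ Y) : FactorsThroughObj W f := by
  obtain ⟨n | n, hn⟩ := hU
  · exact ⟨U, 𝟙 U, f, hn, by simp⟩
  · obtain ⟨A, B, x, y, hA, hB, hxy⟩ := hn
    obtain ⟨g, hg⟩ := hxy.exists_extend (hCP.1.ext_eq_zero B Y ⟨n, hB⟩ hY) f
    exact ⟨A, x, g, hA, hg⟩

end Subcategories

end ExtriangulatedStructure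

/-! ### The ideal of maps factoring through a subcategory -/

section Factorization

variable {C : Type u} [Category.{v} C] {P : ObjectProperty C}

theorem FactorsThroughObj.comp_left {X Y Y' : C} {f : X ⟶ Y} (h : FactorsThroughObj P f)
    (g : Y ⟶ Y') : FactorsThroughObj P (f ≫ g) := by
  obtain ⟨S, a, b, hS, rfl⟩ := h
  exact ⟨S, a, b ≫ g, hS, by simp⟩

theorem FactorsThroughObj.comp_right {X X' Y : C} {f : X ⟶ Y} (h : FactorsThroughObj P f)
    (g : X' ⟶ X) : FactorsThroughObj P (g ≫ f) := by
  obtain ⟨S, a, b, hS, rfl⟩ := h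
  exact ⟨S, g ≫ a, b, hS, by simp⟩

variable [Preadditive C]

theorem FactorsThroughObj.neg {X Y : C} {f : X ⟶ Y} (h : FactorsThroughObj P f) :
    FactorsThroughObj P (-f) := by
  obtain ⟨S, a, b, hS, rfl⟩ := h
  exact ⟨S, a, -b, hS, by simp⟩

variable [HasBinaryBiproducts C]

theorem FactorsThroughObj.add (hP : IsAdditiveSubcategory P) {X Y : C} {f g : X ⟶ Y}
    (hf : FactorsThroughObj P f) (hg : FactorsThroughObj P g) : FactorsThroughObj P (f + g) := by
  obtain ⟨S, a, b, hS, rfl⟩ := hf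
  obtain ⟨S', a', b', hS', rfl⟩ := hg
  exact ⟨S ⊞ S', biprod.lift a a', biprod.desc b b', hP.biprod hS hS', by simp⟩

theorem factorsThroughObj_zero [HasZeroObject C] (hP : IsAdditiveSubcategory P) {X Y : C} :
    FactorsThroughObj P (0 : X ⟶ Y) :=
  ⟨_, 0, 0, hP.of_isZero (isZero_zero C), by simp⟩

end Factorization

/-! ### Replacements and lifts of morphisms -/

namespace ExtriangulatedStructure

section Replacement

variable {C : Type u} [Category.{v} C] [Preadditive C] [HasBinaryBiproducts C]

/-- A pair of `E`-triangles `X ⟶ X⁺ ⟶ U` and `V ⟶ Z ⟶ X⁺` with `U ∈ P^∨`, `X⁺ ∈ P^⊥`, `V ∈ P^∧` and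
`Z ∈ ^⊥P ∩ P^⊥`. -/
structure Replacement (T : ExtriangulatedStructure.{w} C) (P : ObjectProperty C) (X : C) where
  plus : C
  U : C
  b : X ⟶ plus
  u : plus ⟶ U
  triangle_plus : T.IsTriangle b u
  plus_mem : T.rightPerp P plus
  U_mem : T.vee P U
  V : C
  Z : C
  i : V ⟶ Z
  z : Z ⟶ plus
  triangle_Z : T.IsTriangle i z
  V_mem : T.wedge P V
  Z_mem : T.zProp P Z

variable {T : ExtriangulatedStructure.{w} C} {W : ObjectProperty C}

/-- The replacement of an object given by a choice of approximations. -/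
abbrev ApproxChoice.replacement (A : T.ApproxChoice W) (X : C) : T.Replacement W X :=
  ⟨A.plus X, A.U X, A.b X, A.u X, A.triangle_plus X, A.plus_mem X, A.U_mem X, A.V X, A.Z X, A.i X,
    A.z X, A.triangle_Z X, A.V_mem X, A.Z_mem X⟩

/-- `ζ` lies over `f`. -/
def Replacement.IsLift {X Y : C} (R : T.Replacement W X) (S : T.Replacement W Y) (f : X ⟶ Y)
    (ζ : R.Z ⟶ S.Z) : Prop :=
  ∃ fp : R.plus ⟶ S.plus, R.b ≫ fp = f ≫ S.b ∧ ζ ≫ S.z = R.z ≫ fp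

theorem Replacement.IsLift.comp {X Y Y' : C} {R : T.Replacement W X} {S : T.Replacement W Y}
    {S' : T.Replacement W Y'} {f : X ⟶ Y} {g : Y ⟶ Y'} {ζ : R.Z ⟶ S.Z} {ξ : S.Z ⟶ S'.Z}
    (hf : R.IsLift S f ζ) (hg : S.IsLift S' g ξ) : R.IsLift S' (f ≫ g) (ζ ≫ ξ) := by
  obtain ⟨fp, h₁, h₂⟩ := hf
  obtain ⟨gp, h₃, h₄⟩ := hg
  exact ⟨fp ≫ gp, by rw [← Category.assoc, h₁, Category.assoc, h₃, Category.assoc],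
    by rw [Category.assoc, h₄, ← Category.assoc, h₂, Category.assoc]⟩

theorem Replacement.isLift_id {X : C} (R : T.Replacement W X) : R.IsLift R (𝟙 X) (𝟙 R.Z) :=
  ⟨𝟙 _, by simp, by simp⟩

theorem Replacement.isLift_zero {X Y : C} (R : T.Replacement W X) (S : T.Replacement W Y) :
    R.IsLift S 0 0 :=
  ⟨0, by simp, by simp⟩

variable [HasZeroObject C]

theorem Replacement.exists_isLift (hCP : T.CP W) {X Y : C} (R : T.Replacement W X)
    (S : T.Replacement W Y) (f : X ⟶ Y) : ∃ ζ, R.IsLift S f ζ := by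
  obtain ⟨fp, hfp⟩ :=
    R.triangle_plus.exists_extend (hCP.1.ext_eq_zero _ _ R.U_mem S.plus_mem) (f ≫ S.b)
  obtain ⟨ζ, hζ⟩ :=
    S.triangle_Z.exists_factor (hCP.2.ext_eq_zero _ _ R.Z_mem.1 S.V_mem) (R.z ≫ fp)
  exact ⟨ζ, fp, hfp, hζ⟩

/-- The factorization of `ζ ≫ z` through `W₀` lifts to `Z` since `E(W₀, V) = 0`. The error term then
comes from a map into `V`, which itself factors through `W`. -/
theorem Replacement.factorsThroughObj (hW : T.IsPresilting W) (hCP : T.CP W) {X Z : C}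
    (S : T.Replacement W X) (hZ : T.leftPerp W Z) (ζ : Z ⟶ S.Z)
    (h : FactorsThroughObj W (ζ ≫ S.z)) : FactorsThroughObj W ζ := by
  obtain ⟨W₀, g, h, hW₀, e⟩ := h
  obtain ⟨k, hk⟩ :=
    S.triangle_Z.exists_factor (hCP.2.ext_eq_zero _ _ (le_leftPerp hW W₀ hW₀) S.V_mem) h
  obtain ⟨l, hl⟩ := S.triangle_Z.exists_lift (ζ - g ≫ k) (by simp [hk, e])
  have h₁ := (factorsThroughObj_of_wedge hCP hZ S.V_mem l).comp_left S.i
  have h₂ : FactorsThroughObj W (g ≫ k) := ⟨W₀, g, k, hW₀, rfl⟩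
  have h₃ := h₁.add hW.1 h₂
  rwa [hl, sub_add_cancel] at h₃

theorem Replacement.IsLift.factorsThroughObj_sub (hW : T.IsPresilting W) (hCP : T.CP W) {X Y : C}
    {R : T.Replacement W X} {S : T.Replacement W Y} {f : X ⟶ Y} {ζ ξ : R.Z ⟶ S.Z}
    (hζ : R.IsLift S f ζ) (hξ : R.IsLift S f ξ) : FactorsThroughObj W (ζ - ξ) := by
  obtain ⟨fp, h₁, h₂⟩ := hζ
  obtain ⟨gp, h₃, h₄⟩ := hξ
  -- The two choices of `f⁺` agree on `X`, so they differ by a map `U → Y⁺`, which factors through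
  -- `W`.
  obtain ⟨g, hg⟩ := R.triangle_plus.exists_desc (fp - gp) (by simp [h₁, h₃])
  apply S.factorsThroughObj hW hCP R.Z_mem.1
  have := (factorsThroughObj_of_vee hCP R.U_mem S.plus_mem g).comp_right (R.z ≫ R.u)
  rw [Category.assoc, hg, Preadditive.comp_sub] at this
  rwa [Preadditive.sub_comp, h₂, h₄]

/-- The composite `X → Y → Y⁺` is an inflation whose cone is an extension of the old `U_Y` by `U`,
hence again in `W^∨`; the second triangle is left untouched. -/
theorem Replacement.exists_of_inflation (hCP : T.CP W) {X Y U : C} {f : X ⟶ Y} {g : Y ⟶ U}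
    (h : T.IsTriangle f g) (hU : T.vee W U) (S : T.Replacement W Y) :
    ∃ (R : T.Replacement W X) (ζ : R.Z ≅ S.Z), R.IsLift S f ζ.hom := by
  obtain ⟨G, q, d, e, h₁, h₂⟩ := h.comp_inflation S.triangle_plus
  exact ⟨⟨S.plus, G, f ≫ S.b, q, h₁, S.plus_mem, hCP.1.ext_closed_left h₂ hU S.U_mem, S.V, S.Z,
    S.i, S.z, S.triangle_Z, S.V_mem, S.Z_mem⟩, Iso.refl _, 𝟙 _, by simp, by simp⟩

/-- The new `Y⁺` is the cone of `V → X → X⁺`. The fibre of `Z → X⁺ → Y⁺` is an extension of `V` by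
the old fibre, so it stays in `W^∧` and `Z` can be kept. -/
theorem Replacement.exists_of_deflation (hProj : T.HasEnoughProjectives) (hW : T.IsPresilting W)
    (hCP : T.CP W) {V X Y : C} {i : V ⟶ X} {p : X ⟶ Y} (h : T.IsTriangle i p)
    (hV : T.wedge W V) (R : T.Replacement W X) :
    ∃ (S : T.Replacement W Y) (ζ : R.Z ≅ S.Z), R.IsLift S p ζ.hom := by
  obtain ⟨δ, hδ⟩ := h
  obtain ⟨ε, hε⟩ := R.triangle_plus
  obtain ⟨G, q, d, e, δ', h₁, h₂, -, h₃, -⟩ := T.et4 _ _ _ _ _ _ hδ hε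
  obtain ⟨K, j, d', e', h₄, h₅⟩ := R.triangle_Z.comp_deflation ⟨_, h₁⟩
  exact ⟨⟨G, R.U, d, e, ⟨_, h₃⟩,
    rightPerp_cone hProj ⟨_, h₁⟩ (wedge_le_rightPerp hProj hW V hV) R.plus_mem, R.U_mem,
    K, R.Z, j, R.z ≫ q, h₄, hCP.2.ext_closed_right h₅ R.V_mem hV, R.Z_mem⟩, Iso.refl _, q,
    h₂.symm, by simp⟩

end Replacement

/-! ### The functor to the subfactor category and its kernel -/

section Subfactor

variable {C : Type u} [Category.{v} C] [Preadditive C] [HasBinaryBiproducts C]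
  {T : ExtriangulatedStructure.{w} C} {W : ObjectProperty C}

theorem subfactorMap_comp {X Y Z : C} (hX : T.zProp W X) (hY : T.zProp W Y) (hZ : T.zProp W Z)
    (f : X ⟶ Y) (g : Y ⟶ Z) :
    T.subfactorMap W hX hZ (f ≫ g) = T.subfactorMap W hX hY f ≫ T.subfactorMap W hY hZ g :=
  (CategoryTheory.Quotient.functor (T.idealRel W)).map_comp (X := ⟨X, hX⟩) (Y := ⟨Y, hY⟩)
    (Z := ⟨Z, hZ⟩) (ObjectProperty.homMk f) (ObjectProperty.homMk g)

theorem subfactorMap_id {X : C} (hX : T.zProp W X) :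
    T.subfactorMap W hX hX (𝟙 X) = 𝟙 _ :=
  (CategoryTheory.Quotient.functor (T.idealRel W)).map_id _

theorem subfactorMap_eq {X Y : C} (hX : T.zProp W X) (hY : T.zProp W Y) {f g : X ⟶ Y}
    (h : FactorsThroughObj W (f - g)) : T.subfactorMap W hX hY f = T.subfactorMap W hX hY g :=
  CategoryTheory.Quotient.sound _ h

theorem ApproxChoice.plus_mem_wedge {A : T.ApproxChoice W} {X : C} (h : W (A.Z X)) : T.wedge W (A.plus X) := by
  obtain ⟨n, hn⟩ := A.V_mem X
  exact ⟨n + 1, _, _, _, _, hn, h, A.triangle_Z X⟩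

variable [HasZeroObject C]

theorem idealRel_congruence (hW : IsAdditiveSubcategory W) : Congruence (T.idealRel W) where
  equivalence :=
    { refl := fun f => by simpa [idealRel] using factorsThroughObj_zero hW
      symm := fun h => by simpa [idealRel] using h.neg
      trans := fun h h' => by simpa [idealRel] using h.add hW h' }
  comp_left f _ _ h := by simpa [idealRel] using h.comp_right f.hom
  comp_right g h := by simpa [idealRel] using h.comp_left g.hom

theorem mem_of_factorsThroughObj_id (hWIC : T.WIC) (hW : IsAdditiveSubcategory W) {X : C}
    (h : FactorsThroughObj W (𝟙 X)) : W X := by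
  obtain ⟨S, g, h, hS, e⟩ := h
  exact mem_of_retract hWIC hW g h e hS

/-- The identity of `Y` is, modulo maps through `W`, a composite through `X`; so it factors through
`W` and `Y` is a retract of an object of `W`. -/
theorem mem_of_subfactor_iso (hWIC : T.WIC) (hW : IsAdditiveSubcategory W) {X Y : C}
    {hX : T.zProp W X} {hY : T.zProp W Y} (e : T.subfactorObj W X hX ≅ T.subfactorObj W Y hY)
    (h : W X) : W Y := by
  have := idealRel_congruence (T := T) hW
  obtain ⟨p, hp⟩ := (CategoryTheory.Quotient.functor (T.idealRel W)).map_surjective e.hom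
  obtain ⟨m, hm⟩ := (CategoryTheory.Quotient.functor (T.idealRel W)).map_surjective e.inv
  have h₁ : T.idealRel W (𝟙 _) (m ≫ p) := by
    rw [← CategoryTheory.Quotient.functor_map_eq_iff (T.idealRel W), Functor.map_comp, hp, hm,
      e.inv_hom_id]
    exact CategoryTheory.Functor.map_id _ _
  have h₂ : FactorsThroughObj W (m.hom ≫ p.hom) := ⟨X, m.hom, p.hom, h, rfl⟩
  have h₃ := FactorsThroughObj.add hW h₁ h₂
  apply mem_of_factorsThroughObj_id hWIC hW
  simpa using h₃

/-- The class in the subfactor category of a morphism between replacements. -/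
abbrev Replacement.cls {X Y : C} (R : T.Replacement W X) (S : T.Replacement W Y)
    (ζ : R.Z ⟶ S.Z) : T.subfactorObj W R.Z R.Z_mem ⟶ T.subfactorObj W S.Z S.Z_mem :=
  T.subfactorMap W R.Z_mem S.Z_mem ζ

theorem Replacement.IsLift.cls_eq (hW : T.IsPresilting W) (hCP : T.CP W) {X Y : C}
    {R : T.Replacement W X} {S : T.Replacement W Y} {f : X ⟶ Y} {ζ ξ : R.Z ⟶ S.Z}
    (hζ : R.IsLift S f ζ) (hξ : R.IsLift S f ξ) : R.cls S ζ = R.cls S ξ :=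
  subfactorMap_eq _ _ (hζ.factorsThroughObj_sub hW hCP hξ)

/-- Uniqueness of replacements: lifts of the identity in the two directions compose to lifts of the
identity, which are unique in `Z/[W]`. -/
theorem Replacement.IsLift.isIso_cls (hW : T.IsPresilting W) (hCP : T.CP W) {X : C}
    {R S : T.Replacement W X} {ζ : R.Z ⟶ S.Z} (hζ : R.IsLift S (𝟙 X) ζ) : IsIso (R.cls S ζ) := by
  obtain ⟨ξ, hξ⟩ := S.exists_isLift hCP R (𝟙 X)
  refine ⟨S.cls R ξ, ?_, ?_⟩
  · rw [← subfactorMap_comp, ← subfactorMap_id]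
    exact (hζ.comp hξ).cls_eq hW hCP (by simpa using R.isLift_id)
  · rw [← subfactorMap_comp, ← subfactorMap_id]
    exact (hξ.comp hζ).cls_eq hW hCP (by simpa using S.isLift_id)

theorem ApproxChoice.exists_inducedFunctor (hW : T.IsPresilting W) (hCP : T.CP W)
    (A : T.ApproxChoice W) : Nonempty A.InducedFunctor := by
  have H := fun {X Y : C} (f : X ⟶ Y) =>
    (A.replacement X).exists_isLift hCP (A.replacement Y) f
  choose ζ hζ using @H
  exact ⟨{ map := fun {X Y} f => (A.replacement X).cls (A.replacement Y) (ζ f)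
           map_id := fun X => by
             rw [← subfactorMap_id]
             exact (hζ (𝟙 X)).cls_eq hW hCP (A.replacement X).isLift_id
           map_comp := fun f g => by
             rw [← subfactorMap_comp]
             exact (hζ (f ≫ g)).cls_eq hW hCP ((hζ f).comp (hζ g))
           exists_lift := fun f => ⟨ζ f, hζ f⟩
           map_eq := fun f ξ hξ => (hζ f).cls_eq hW hCP hξ }⟩

variable {A : T.ApproxChoice W} (G : A.InducedFunctor)

/-- Invertibility of `G(f)` may be tested on any replacements of `X` and `Y`, not only the chosen
ones. -/
theorem ApproxChoice.InducedFunctor.isIso_map (hW : T.IsPresilting W) (hCP : T.CP W) {X Y : C}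
    {f : X ⟶ Y} {R : T.Replacement W X} {S : T.Replacement W Y} (ζ : R.Z ≅ S.Z)
    (h : R.IsLift S f ζ.hom) : IsIso (G.functor.map f) := by
  obtain ⟨ζ₁, h₁⟩ := (A.replacement X).exists_isLift hCP R (𝟙 X)
  obtain ⟨ζ₂, h₂⟩ := S.exists_isLift hCP (A.replacement Y) (𝟙 Y)
  have h₃ : A.IsLift f (ζ₁ ≫ ζ.hom ≫ ζ₂) := by
    have := h₁.comp (h.comp h₂)
    rwa [Category.comp_id, Category.id_comp] at this
  have e : G.functor.map f = (A.replacement X).cls R ζ₁ ≫ R.cls S ζ.hom ≫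
      S.cls (A.replacement Y) ζ₂ := by
    rw [← subfactorMap_comp, ← subfactorMap_comp]
    exact G.map_eq f _ h₃
  have i₁ := h₁.isIso_cls hW hCP
  have i₂ := h₂.isIso_cls hW hCP
  have i₃ : IsIso (R.cls S ζ.hom) :=
    ⟨S.cls R ζ.inv, by rw [← subfactorMap_comp, Iso.hom_inv_id, subfactorMap_id],
      by rw [← subfactorMap_comp, Iso.inv_hom_id, subfactorMap_id]⟩
  rw [e]
  exact IsIso.comp_isIso' i₁ (IsIso.comp_isIso' i₃ i₂)

theorem ApproxChoice.InducedFunctor.isIso_map_inflation (hW : T.IsPresilting W) (hCP : T.CP W)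
    {X Y U : C} {f : X ⟶ Y} {g : Y ⟶ U} (h : T.IsTriangle f g) (hU : T.vee W U) :
    IsIso (G.functor.map f) := by
  obtain ⟨R, ζ, hζ⟩ := Replacement.exists_of_inflation hCP h hU (A.replacement Y)
  exact G.isIso_map hW hCP ζ hζ

theorem ApproxChoice.InducedFunctor.isIso_map_deflation (hProj : T.HasEnoughProjectives)
    (hW : T.IsPresilting W) (hCP : T.CP W) {V X Y : C} {i : V ⟶ X} {p : X ⟶ Y}
    (h : T.IsTriangle i p) (hV : T.wedge W V) : IsIso (G.functor.map p) := by
  obtain ⟨S, ζ, hζ⟩ := Replacement.exists_of_deflation hProj hW hCP h hV (A.replacement X)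
  exact G.isIso_map hW hCP ζ hζ

theorem ApproxChoice.InducedFunctor.isIso_map_of_cone (hProj : T.HasEnoughProjectives)
    (hW : T.IsPresilting W) (hCP : T.CP W) {X Y M : C} {f : X ⟶ Y} {g : Y ⟶ M}
    (h : T.IsTriangle f g) (hM : T.cone (T.wedge W) (T.vee W) M) : IsIso (G.functor.map f) := by
  obtain ⟨V, U, i, p, hV, hU, hip⟩ := hM
  -- Here `f` becomes `X → F → Y`, an inflation with cone `U` followed by a deflation with fibre
  -- `V`.
  obtain ⟨F, d, e, j, b, h₁, h₂, rfl⟩ := h.exists_pullback hip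
  have i₁ := G.isIso_map_inflation hW hCP h₁ hU
  have i₂ := G.isIso_map_deflation hProj hW hCP h₂ hV
  rw [Functor.map_comp]
  infer_instance

theorem ApproxChoice.InducedFunctor.mem_iff (hWIC : T.WIC) (hW : T.IsPresilting W) {X Y : C}
    {f : X ⟶ Y} (h : IsIso (G.functor.map f)) : W (A.Z X) ↔ W (A.Z Y) :=
  ⟨mem_of_subfactor_iso hWIC hW.1 (@asIso _ _ _ _ (G.functor.map f) h),
    mem_of_subfactor_iso hWIC hW.1 (@asIso _ _ _ _ (G.functor.map f) h).symm⟩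

theorem ApproxChoice.mem_of_retract (A : T.ApproxChoice W) (hWIC : T.WIC) (hW : T.IsPresilting W)
    (hCP : T.CP W) {X Y : C}
    (m : X ⟶ Y) (p : Y ⟶ X) (h : m ≫ p = 𝟙 X) (hY : W (A.Z Y)) : W (A.Z X) := by
  obtain ⟨ζ, hζ⟩ := (A.replacement X).exists_isLift hCP (A.replacement Y) m
  obtain ⟨ξ, hξ⟩ := (A.replacement Y).exists_isLift hCP (A.replacement X) p
  have h₁ := hζ.comp hξ
  rw [h] at h₁
  have h₂ := (A.replacement X).isLift_id.factorsThroughObj_sub hW hCP h₁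
  have h₃ : FactorsThroughObj W (ζ ≫ ξ) := ⟨_, ζ, ξ, hY, rfl⟩
  apply mem_of_factorsThroughObj_id hWIC hW.1
  have h₄ := h₂.add hW.1 h₃
  rwa [sub_add_cancel] at h₄

/-- On a zero object `0 = 1`, so both `0` and `1` on `Z_X` are lifts of it, and `1` factors through
`W`. -/
theorem ApproxChoice.mem_of_isZero (A : T.ApproxChoice W) (hWIC : T.WIC) (hW : T.IsPresilting W) (hCP : T.CP W) {X : C}
    (hX : IsZero X) : W (A.Z X) := by
  apply mem_of_factorsThroughObj_id hWIC hW.1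
  have h₀ := (A.replacement X).isLift_zero (A.replacement X)
  rw [← hX.eq_of_src (𝟙 X) 0] at h₀
  simpa using (A.replacement X).isLift_id.factorsThroughObj_sub hW hCP h₀

/-- The objects killed by the induced functor. -/
theorem ApproxChoice.mem_iff_cone (A : T.ApproxChoice W) (hProj : T.HasEnoughProjectives) (hWIC : T.WIC)
    (hW : T.IsPresilting W) (hCP : T.CP W) (M : C) :
    W (A.Z M) ↔ T.cone (T.wedge W) (T.vee W) M := by
  obtain ⟨G⟩ := A.exists_inducedFunctor hW hCP
  constructor
  · intro h
    obtain ⟨n, hn⟩ := A.U_mem M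
    -- The fibre `F` of `Z → M⁺ → U` is in `W^∨`, one step longer than `U`, because `Z` is in `W`;
    -- and `V → F → M` is the required triangle.
    obtain ⟨F, j, d, e, h₁, h₂⟩ := (A.triangle_Z M).comp_deflation (A.triangle_plus M)
    exact ⟨A.V M, F, d, e, A.V_mem M, ⟨n + 1, A.Z M, A.U M, j, _, h, hn, h₁⟩, h₂⟩
  · rintro ⟨V, U, i, p, hV, hU, h⟩
    -- `G` inverts both `U → M` and `0 → U`, so the claim reduces to the zero object.
    rw [← G.mem_iff hWIC hW (G.isIso_map_deflation hProj hW hCP h hV),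
      ← G.mem_iff hWIC hW (G.isIso_map_inflation hW hCP
        ⟨_, T.realizes_id_left (isZero_zero C) U⟩ hU)]
    exact A.mem_of_isZero hWIC hW hCP (isZero_zero C)

theorem ApproxChoice.isThick (A : T.ApproxChoice W) (hProj : T.HasEnoughProjectives) (hWIC : T.WIC)
    (hW : T.IsPresilting W) (hCP : T.CP W) : T.IsThick (fun X => W (A.Z X)) where
  additive :=
    { of_iso := fun {X Y} e h => A.mem_of_retract hWIC hW hCP e.inv e.hom e.inv_hom_id h
      of_isZero := fun h => A.mem_of_isZero hWIC hW hCP h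
      biprod := fun {X Y} hX hY => by
        rw [A.mem_iff_cone hProj hWIC hW hCP] at hX hY ⊢
        obtain ⟨V, U, i, p, hV, hU, h⟩ := hX
        obtain ⟨V', U', i', p', hV', hU', h'⟩ := hY
        exact ⟨_, _, _, _, hCP.2.right.biprod hV hV', hCP.1.left.biprod hU hU', h.biprod_map h'⟩
      summand := fun {X Y} h =>
        A.mem_of_retract hWIC hW hCP biprod.inl biprod.fst biprod.inl_fst h }
  mem₁ x y h hB hX :=
    have ⟨G⟩ := A.exists_inducedFunctor hW hCP
    (G.mem_iff hWIC hW (G.isIso_map_of_cone hProj hW hCP h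
      ((A.mem_iff_cone hProj hWIC hW hCP _).1 hX))).2 hB
  mem₂ x y h hA hX :=
    have ⟨G⟩ := A.exists_inducedFunctor hW hCP
    (G.mem_iff hWIC hW (G.isIso_map_of_cone hProj hW hCP h
      ((A.mem_iff_cone hProj hWIC hW hCP _).1 hX))).1 hA
  mem₃ {X Y M} x y h hX hY := by
    obtain ⟨G⟩ := A.exists_inducedFunctor hW hCP
    -- The pushout along `X → X⁺` replaces the fibre `X` by `X⁺`, which is in `W^∧` because `Z_X` is
    -- in `W`. Then `Y → F → M` is an inflation with cone in `W^∨` followed by a deflation with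
    -- fibre in `W^∧`.
    obtain ⟨F, d, e, b, q, h₁, h₂, -⟩ := h.exists_pushout (A.triangle_plus X)
    rw [← G.mem_iff hWIC hW (G.isIso_map_deflation hProj hW hCP h₁ (A.plus_mem_wedge hX)),
      ← G.mem_iff hWIC hW (G.isIso_map_inflation hW hCP h₂ (A.U_mem X))]
    exact hY

theorem ApproxChoice.InducedFunctor.inverts (hProj : T.HasEnoughProjectives) (hWIC : T.WIC)
    (hW : T.IsPresilting W) (hCP : T.CP W) :
    (T.thickInflations W).IsInvertedBy G.functor := by
  rintro X Y f ⟨M, g, hM, h⟩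
  refine G.isIso_map_of_cone hProj hW hCP h ((A.mem_iff_cone hProj hWIC hW hCP M).1 ?_)
  refine hM _ (A.isThick hProj hWIC hW hCP) fun S hS => ?_
  refine (A.mem_iff_cone hProj hWIC hW hCP S).2 ?_
  exact ⟨_, S, 0, 𝟙 S, hCP.2.right.of_isZero (isZero_zero C), le_vee S hS,
    _, T.realizes_id_left (isZero_zero C) S⟩

end Subfactor

end ExtriangulatedStructure

/-! ### The localization and the inverse equivalence -/

namespace ExtriangulatedStructure

section Localization

variable {C : Type u} [Category.{v} C] [Preadditive C] [HasBinaryBiproducts C]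
  {T : ExtriangulatedStructure.{w} C} {W : ObjectProperty C}

theorem isIso_Q_of_inflation {X Y M : C} {f : X ⟶ Y} {g : Y ⟶ M} (h : T.IsTriangle f g)
    (hM : T.thick W M) : IsIso ((T.thickInflations W).Q.map f) :=
  (T.thickInflations W).Q_inverts f ⟨M, g, hM, h⟩

/-- The projection is a left inverse of the inclusion of `X`, which lies in the inverted class. -/
theorem isIso_Q_fst (X : C) {M : C} (hM : T.thick W M) :
    IsIso ((T.thickInflations W).Q.map (biprod.fst : X ⊞ M ⟶ X)) := by
  have h₁ := isIso_Q_of_inflation (W := W) (isTriangle_biprod (T := T) X M) hM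
  have h₂ : (T.thickInflations W).Q.map (biprod.inl : X ⟶ X ⊞ M) ≫
      (T.thickInflations W).Q.map biprod.fst = 𝟙 _ := by
    rw [← Functor.map_comp, biprod.inl_fst, CategoryTheory.Functor.map_id]
  have h₃ : IsIso ((T.thickInflations W).Q.map (biprod.inl : X ⟶ X ⊞ M) ≫
      (T.thickInflations W).Q.map biprod.fst) := h₂ ▸ inferInstance
  exact IsIso.of_isIso_comp_left ((T.thickInflations W).Q.map (biprod.inl : X ⟶ X ⊞ M)) _

/-- A cylinder argument with `X ⊞ S`: the sections `(1, a)` and `(1, 0)` of the invertible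
projection to `X` become equal, and `(g, b)` composed with them gives `f` and `g`. -/
theorem Q_map_eq_of_factorsThroughObj {X Y : C} {f g : X ⟶ Y}
    (h : FactorsThroughObj W (f - g)) :
    (T.thickInflations W).Q.map f = (T.thickInflations W).Q.map g := by
  obtain ⟨S, a, b, hS, e⟩ := h
  have i := isIso_Q_fst (T := T) X (le_thick S hS)
  have h₁ : (T.thickInflations W).Q.map (biprod.lift (𝟙 X) a) =
      (T.thickInflations W).Q.map biprod.inl := by
    rw [← cancel_mono ((T.thickInflations W).Q.map (biprod.fst : X ⊞ S ⟶ X)), ← Functor.map_comp,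
      ← Functor.map_comp, biprod.lift_fst, biprod.inl_fst]
  have h₂ : f = biprod.lift (𝟙 X) a ≫ biprod.desc g b := by
    rw [biprod.lift_desc, Category.id_comp, e, add_sub_cancel]
  rw [h₂, Functor.map_comp, h₁, ← Functor.map_comp, biprod.inl_desc]

variable [HasZeroObject C]

open ZeroObject

/-- Deflations with fibre in `thick W` become invertible, too. -/
theorem isIso_Q_of_deflation (hCP : T.CP W) {V X Y : C} {i : V ⟶ X} {p : X ⟶ Y}
    (h : T.IsTriangle i p) (hV : T.thick W V) : IsIso ((T.thickInflations W).Q.map p) := by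
  -- An inflation `X → V'` into `W^∧` turns `p` into the inflation `(-p, x) : X → Y ⊞ V'`. Its cone
  -- is also the cone of `V → V'`, hence in `thick W`; projecting `V'` away recovers `-p`.
  obtain ⟨V', U', x, y, hV', -, hxy⟩ := hCP.2.mem_cocone X
  obtain ⟨G, q, r, h₁, h₂⟩ := h.exists_pushout_deflation hxy
  have hV'' := wedge_le_thick V' hV'
  have i₁ := isIso_Q_of_inflation h₂ (thick_isThick.mem₃ _ _ h₁ hV hV'')
  have i₂ := isIso_Q_fst (T := T) Y hV''
  have e : p = (biprod.lift (-p) x ≫ biprod.fst) ≫ (negIso Y).hom := by simp [negIso]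
  rw [e, Functor.map_comp, Functor.map_comp]
  infer_instance

/-- The functor from the subfactor category to the localization. -/
noncomputable def subfactorToLocalization (T : ExtriangulatedStructure.{w} C) (W : ObjectProperty C) :
    T.subfactor W ⥤ T.thickLocalization W :=
  CategoryTheory.Quotient.lift _ ((T.zProp W).ι ⋙ (T.thickInflations W).Q)
    fun _ _ _ _ h => Q_map_eq_of_factorsThroughObj h

/-- An object of the subfactor category is its own replacement. -/
noncomputable abbrev Replacement.self (hCP : T.CP W) {X : C} (hX : T.zProp W X) :
    T.Replacement W X where
  plus := X
  U := 0
  b := 𝟙 X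
  u := 0
  triangle_plus := ⟨0, T.realizes_id_right (isZero_zero C) X⟩
  plus_mem := hX.2
  U_mem := hCP.1.left.of_isZero (isZero_zero C)
  V := 0
  Z := X
  i := 0
  z := 𝟙 X
  triangle_Z := ⟨0, T.realizes_id_left (isZero_zero C) X⟩
  V_mem := hCP.2.right.of_isZero (isZero_zero C)
  Z_mem := hX

variable {A : T.ApproxChoice W} (G : A.InducedFunctor)

/-- On the subfactor category, the induced functor is isomorphic to the identity. -/
theorem ApproxChoice.InducedFunctor.nonempty_iso (hW : T.IsPresilting W) (hCP : T.CP W) :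
    Nonempty ((T.zProp W).ι ⋙ G.functor ≅ CategoryTheory.Quotient.functor (T.idealRel W)) := by
  have H := fun X : (T.zProp W).FullSubcategory =>
    (A.replacement X.obj).exists_isLift hCP (Replacement.self hCP X.property) (𝟙 X.obj)
  choose ζ hζ using H
  let e (X : (T.zProp W).FullSubcategory) :
      ((T.zProp W).ι ⋙ G.functor).obj X ≅ (CategoryTheory.Quotient.functor (T.idealRel W)).obj X :=
    @asIso _ _ _ _ ((A.replacement X.obj).cls (Replacement.self hCP X.property) (ζ X))
      ((hζ X).isIso_cls hW hCP)
  refine ⟨NatIso.ofComponents e fun {X Y} f => ?_⟩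
  obtain ⟨ξ, hξ⟩ := G.exists_lift f.hom
  have h₁ : G.functor.map f.hom = (A.replacement X.obj).cls (A.replacement Y.obj) ξ :=
    G.map_eq f.hom ξ hξ
  have hf : (Replacement.self hCP X.property).IsLift (Replacement.self hCP Y.property) f.hom f.hom :=
    ⟨f.hom, by simp [Replacement.self], by simp [Replacement.self]⟩
  have h₂ := Replacement.IsLift.comp (R := A.replacement X.obj) (S := A.replacement Y.obj) hξ (hζ Y)
  have h₃ := (hζ X).comp hf
  rw [Category.comp_id] at h₂
  rw [Category.id_comp] at h₃
  have h₄ := h₂.cls_eq hW hCP h₃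
  refine (congrArg (· ≫ (e Y).hom) h₁).trans ?_
  exact (subfactorMap_comp (A.Z_mem X.obj) (A.Z_mem Y.obj) Y.property ξ (ζ Y)).symm.trans
    (h₄.trans (subfactorMap_comp (A.Z_mem X.obj) X.property Y.property (ζ X) f.hom))

/-- In the localization, the induced functor is isomorphic to the localization functor. -/
theorem ApproxChoice.InducedFunctor.nonempty_iso_Q (hCP : T.CP W) :
    Nonempty (G.functor ⋙ T.subfactorToLocalization W ≅ (T.thickInflations W).Q) := by
  have i₁ (X : C) : IsIso ((T.thickInflations W).Q.map (A.z X)) :=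
    isIso_Q_of_deflation hCP (A.triangle_Z X) (wedge_le_thick _ (A.V_mem X))
  have i₂ (X : C) : IsIso ((T.thickInflations W).Q.map (A.b X)) :=
    isIso_Q_of_inflation (A.triangle_plus X) (vee_le_thick _ (A.U_mem X))
  let e (X : C) : (G.functor ⋙ T.subfactorToLocalization W).obj X ≅ (T.thickInflations W).Q.obj X :=
    @asIso _ _ _ _ ((T.thickInflations W).Q.map (A.z X)) (i₁ X) ≪≫
      (@asIso _ _ _ _ ((T.thickInflations W).Q.map (A.b X)) (i₂ X)).symm
  refine ⟨NatIso.ofComponents e fun {X Y} f => ?_⟩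
  obtain ⟨ζ, fp, h₁, h₂⟩ := G.exists_lift f
  have h₃ : (G.functor ⋙ T.subfactorToLocalization W).map f = (T.thickInflations W).Q.map ζ := by
    change (T.subfactorToLocalization W).map (G.map f) = _
    rw [G.map_eq f ζ ⟨fp, h₁, h₂⟩]
    rfl
  rw [h₃]
  change (T.thickInflations W).Q.map ζ ≫ (T.thickInflations W).Q.map (A.z Y) ≫
      inv ((T.thickInflations W).Q.map (A.b Y)) =
    ((T.thickInflations W).Q.map (A.z X) ≫ inv ((T.thickInflations W).Q.map (A.b X))) ≫
      (T.thickInflations W).Q.map f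
  rw [← Category.assoc, IsIso.comp_inv_eq, Category.assoc, Category.assoc, ← Functor.map_comp,
    ← Functor.map_comp, ← h₁, h₂, Functor.map_comp, Functor.map_comp, IsIso.inv_hom_id_assoc]

theorem ApproxChoice.InducedFunctor.isEquivalence_lift (hW : T.IsPresilting W) (hCP : T.CP W)
    (hG : (T.thickInflations W).IsInvertedBy G.functor) :
    (Localization.Construction.lift G.functor hG).IsEquivalence := by
  obtain ⟨α⟩ := G.nonempty_iso hW hCP
  obtain ⟨β⟩ := G.nonempty_iso_Q hCP
  set H := Localization.Construction.lift G.functor hG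
  have γ : (T.thickInflations W).Q ⋙ H ≅ G.functor := eqToIso (Localization.Construction.fac _ _)
  have unit : 𝟭 (T.thickLocalization W) ≅ H ⋙ T.subfactorToLocalization W := by
    -- Both functors out of the localization are compared after composition with `Q`, where they
    -- become `Q` up to isomorphism.
    let l₁ : Localization.Lifting (T.thickInflations W).Q (T.thickInflations W)
      (G.functor ⋙ T.subfactorToLocalization W) (H ⋙ T.subfactorToLocalization W) :=
      ⟨Functor.isoWhiskerRight γ (T.subfactorToLocalization W)⟩
    let l₂ : Localization.Lifting (T.thickInflations W).Q (T.thickInflations W)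
      (T.thickInflations W).Q (𝟭 (T.thickLocalization W)) := ⟨Functor.rightUnitor _⟩
    exact Localization.liftNatIso (T.thickInflations W).Q (T.thickInflations W) _ _ _ _ β.symm
  have counit : T.subfactorToLocalization W ⋙ H ≅ 𝟭 (T.subfactor W) :=
    CategoryTheory.Quotient.natIsoLift _
      (Functor.isoWhiskerLeft (T.zProp W).ι γ ≪≫ α ≪≫ (Functor.rightUnitor _).symm)
  exact Functor.IsEquivalence.mk' (T.subfactorToLocalization W) unit counit

end Localization

end ExtriangulatedStructure

/-! ### Minimal maps in Hom-finite Krull–Schmidt categories -/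

section KrullSchmidt

variable {C : Type u} [Category.{v} C] [Preadditive C]

/-- The endomorphism `ψ` lies in the radical: no isomorphism of an object with local endomorphism
ring factors through it. -/
def IsRadicalEndo {Y : C} (ψ : Y ⟶ Y) : Prop :=
  ∀ (L : C), IsLocalRing (End L) → ∀ (s : L ⟶ Y) (r : Y ⟶ L), ¬ IsIso (s ≫ ψ ≫ r)

/-- In the local ring `End X` the sum of `1` and a non-unit is a unit, and `1 + pu` is inverted by
the usual formula `1 - p(1 + up)⁻¹u`. -/
theorem exists_id_add_comp_id_sub {X Y : C} [IsLocalRing (End X)] (p : Y ⟶ X) (u : X ⟶ Y)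
    (h : ¬ IsIso (u ≫ p)) : ∃ z : Y ⟶ Y, (𝟙 Y + p ≫ u) ≫ z = 𝟙 Y := by
  have h₁ : IsIso (𝟙 X + u ≫ p) := by
    rw [← isUnit_iff_isIso]
    refine (IsLocalRing.isUnit_or_isUnit_of_add_one (R := End X) (a := 𝟙 X + u ≫ p)
      (b := -(u ≫ p)) ?_).resolve_right fun h' => h ?_
    · exact add_neg_cancel_right _ _
    · rw [← isUnit_iff_isIso]
      simpa using h'.neg
  refine ⟨𝟙 Y - p ≫ inv (𝟙 X + u ≫ p) ≫ u, ?_⟩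
  have h₂ : (p + p ≫ u ≫ p) ≫ inv (𝟙 X + u ≫ p) ≫ u = p ≫ u := by
    have : p + p ≫ u ≫ p = p ≫ (𝟙 X + u ≫ p) := by simp
    rw [this, Category.assoc, IsIso.hom_inv_id_assoc]
  rw [Preadditive.comp_sub, Category.comp_id]
  have h₃ : (𝟙 Y + p ≫ u) ≫ p ≫ inv (𝟙 X + u ≫ p) ≫ u = p ≫ u := by
    rw [← Category.assoc, Preadditive.add_comp, Category.id_comp, Category.assoc, h₂]
  rw [h₃, add_sub_cancel_right]

/-- A left inverse `z` of `1 - x` equals `1 + zx`, so it too has a left inverse; hence `z` is a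
unit. -/
theorem isUnit_one_sub_of_mem_jacobson_bot {R : Type*} [Ring R] {x : R}
    (hx : x ∈ (⊥ : Ideal R).jacobson) : IsUnit (1 - x) := by
  have key : ∀ x : R, x ∈ (⊥ : Ideal R).jacobson → ∃ z : R, z * (1 - x) = 1 := by
    intro x hx
    obtain ⟨z, hz⟩ := Ideal.mem_jacobson_iff.1 hx (-1)
    rw [Ideal.mem_bot, sub_eq_zero] at hz
    refine ⟨z, ?_⟩
    rw [mul_sub, mul_one]
    refine Eq.trans ?_ hz
    rw [mul_neg, mul_one, neg_mul, sub_eq_neg_add]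
  obtain ⟨z, hz⟩ := key _ hx
  obtain ⟨z', hz'⟩ := key (-(z * x)) (neg_mem (Ideal.mul_mem_left _ _ hx))
  have h₁ : 1 - -(z * x) = z := by
    rw [mul_sub, mul_one, sub_eq_iff_eq_add] at hz
    rw [sub_neg_eq_add]; exact hz.symm
  rw [h₁] at hz'
  have h₂ : z' = 1 - x := left_inv_eq_right_inv hz' hz
  rw [h₂] at hz'
  exact ⟨⟨1 - x, z, hz', hz⟩, rfl⟩

theorem IsRadicalEndo.isIso_id_sub (hKS : IsKrullSchmidt C) {Y : C} {ψ : Y ⟶ Y}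
    (hψ : IsRadicalEndo ψ) : IsIso (𝟙 Y - ψ) := by
  obtain ⟨n, X, b, ⟨hb⟩, ⟨e⟩, hX⟩ := hKS Y
  have total : ∑ i, (e.hom ≫ b.π i) ≫ b.ι i ≫ e.inv = 𝟙 Y := by
    have h := e.hom ≫= (IsBilimit.total hb =≫ e.inv)
    simpa [Preadditive.sum_comp, Preadditive.comp_sum] using h
  have hsum : ψ = ∑ i, (e.hom ≫ b.π i) ≫ b.ι i ≫ e.inv ≫ ψ := by
    conv_lhs => rw [← Category.id_comp ψ, ← total]
    simp [Preadditive.sum_comp]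
  -- It suffices to treat the part of `ψ` through each local summand `X i`, where radicality rules
  -- out isomorphisms of `X i`.
  have hJ : (show End Y from ψ) ∈ (⊥ : Ideal (End Y)).jacobson := by
    rw [hsum]
    refine Ideal.sum_mem (α := End Y) _ fun i _ => ?_
    rw [Ideal.mem_jacobson_iff]
    intro y
    have := hX i
    obtain ⟨z, hz⟩ := exists_id_add_comp_id_sub (e.hom ≫ b.π i) (b.ι i ≫ e.inv ≫ ψ ≫ y)
      (by simpa using hψ _ (hX i) (b.ι i ≫ e.inv) (y ≫ e.hom ≫ b.π i))
    refine ⟨z, ?_⟩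
    rw [Ideal.mem_bot, sub_eq_zero]
    refine Eq.trans ?_ hz
    simp only [End.mul_def, Preadditive.add_comp, Category.assoc, Category.id_comp]
    exact add_comm _ _
  exact (isUnit_iff_isIso _).1 (isUnit_one_sub_of_mem_jacobson_bot hJ)

variable {k : Type*} [Field k] [Linear k C]

/-- Conjugation embeds `End K` into `End Y`, and the identity of `Y` is in the image only if `p ≫ m
= 1`. This dimension is the termination measure for splitting off summands. -/
theorem finrank_end_lt (hFin : ∀ X Y : C, Module.Finite k (X ⟶ Y)) {K Y : C} (m : K ⟶ Y)
    (p : Y ⟶ K) (h : m ≫ p = 𝟙 K) (h' : p ≫ m ≠ 𝟙 Y) :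
    Module.finrank k (K ⟶ K) < Module.finrank k (Y ⟶ Y) := by
  have := hFin Y Y
  let Φ : (K ⟶ K) →ₗ[k] (Y ⟶ Y) :=
    { toFun := fun α => p ≫ α ≫ m
      map_add' := fun α β => by simp
      map_smul' := fun c α => by simp }
  have hΦ : Function.Injective Φ := fun α β hαβ => by
    have : m ≫ (p ≫ α ≫ m) ≫ p = m ≫ (p ≫ β ≫ m) ≫ p := congrArg (fun γ => m ≫ γ ≫ p) hαβ
    simpa [h, reassoc_of% h] using this
  rw [← LinearMap.finrank_range_of_inj hΦ]
  refine Submodule.finrank_lt fun htop => h' ?_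
  obtain ⟨α, hα⟩ := (LinearMap.range_eq_top.1 htop) (𝟙 Y)
  change p ≫ α ≫ m = 𝟙 Y at hα
  have h₁ : α = 𝟙 K := by
    have := m ≫= (hα =≫ p)
    simpa [h, reassoc_of% h] using this
  simpa [h₁] using hα

theorem exists_retract (hFin : ∀ X Y : C, Module.Finite k (X ⟶ Y))
    (hsplit : ∀ {X Y : C} (s : X ⟶ Y) (r : Y ⟶ X), s ≫ r = 𝟙 X →
      ∃ (K : C) (m : K ⟶ Y) (p : Y ⟶ K), m ≫ p = 𝟙 K ∧ p ≫ m = 𝟙 Y - r ≫ s)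
    {L Y : C} (hL : IsLocalRing (End L)) (s : L ⟶ Y) (r : Y ⟶ L) (h : s ≫ r = 𝟙 L) :
    ∃ (K : C) (m : K ⟶ Y) (p : Y ⟶ K), m ≫ p = 𝟙 K ∧ p ≫ m = 𝟙 Y - r ≫ s ∧
      Module.finrank k (K ⟶ K) < Module.finrank k (Y ⟶ Y) := by
  obtain ⟨K, m, p, h₁, h₂⟩ := hsplit s r h
  refine ⟨K, m, p, h₁, h₂, finrank_end_lt hFin m p h₁ fun h₃ => ?_⟩
  have h₄ : r ≫ s = 0 := by
    rw [h₃] at h₂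
    exact sub_eq_self.1 h₂.symm
  have h₅ : (𝟙 L : End L) = 0 := by
    calc 𝟙 L = s ≫ (r ≫ s) ≫ r := by rw [Category.assoc, h, Category.comp_id, h]
      _ = 0 := by rw [h₄, zero_comp, comp_zero]
  exact one_ne_zero (α := End L) h₅

theorem exists_split_of_not_isIso (hKS : IsKrullSchmidt C) {Y : C} (φ : Y ⟶ Y)
    (hφ : ¬ IsIso φ) :
    ∃ (L : C) (s : L ⟶ Y) (r : Y ⟶ L), IsLocalRing (End L) ∧ s ≫ (𝟙 Y - φ) ≫ r = 𝟙 L := by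
  have h : ¬ IsRadicalEndo (𝟙 Y - φ) := fun h => hφ (by simpa using h.isIso_id_sub hKS)
  simp only [IsRadicalEndo, not_forall, not_not] at h
  obtain ⟨L, hL, s, r, i⟩ := h
  have := IsIso.hom_inv_id (s ≫ (𝟙 Y - φ) ≫ r)
  simp only [Category.assoc] at this
  exact ⟨L, s, _, hL, this⟩

theorem exists_minimal_left (hFin : ∀ X Y : C, Module.Finite k (X ⟶ Y)) (hKS : IsKrullSchmidt C)
    (hsplit : ∀ {X Y : C} (s : X ⟶ Y) (r : Y ⟶ X), s ≫ r = 𝟙 X →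
      ∃ (K : C) (m : K ⟶ Y) (p : Y ⟶ K), m ≫ p = 𝟙 K ∧ p ≫ m = 𝟙 Y - r ≫ s)
    {X Y : C} (f : X ⟶ Y) :
    ∃ (Y' : C) (m : Y' ⟶ Y) (p : Y ⟶ Y'), m ≫ p = 𝟙 Y' ∧ f ≫ p ≫ m = f ∧
      ∀ φ : Y' ⟶ Y', (f ≫ p) ≫ φ = f ≫ p → IsIso φ := by
  induction hn : Module.finrank k (Y ⟶ Y) using Nat.strong_induction_on generalizing Y with
  | _ n ih =>
    by_cases H : ∀ φ : Y ⟶ Y, f ≫ φ = f → IsIso φ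
    · exact ⟨Y, 𝟙 Y, 𝟙 Y, by simp, by simp, by simpa using H⟩
    · push Not at H
      obtain ⟨φ, hφ, hφ'⟩ := H
      obtain ⟨L, s, r, hL, h⟩ := exists_split_of_not_isIso hKS φ hφ'
      -- The retraction onto `L` begins with `1 - φ`, which `f` kills; so `f` lands in the
      -- complement `K`, whose endomorphism ring is smaller.
      obtain ⟨K, m, p, h₁, h₂, h₃⟩ := exists_retract hFin hsplit hL s ((𝟙 Y - φ) ≫ r) h
      obtain ⟨Y', m', p', h₄, h₅, h₆⟩ := ih _ (hn ▸ h₃) (f ≫ p) rfl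
      refine ⟨Y', m' ≫ m, p ≫ p', ?_, ?_, fun ψ hψ => h₆ ψ (by simpa using hψ)⟩
      · rw [Category.assoc, reassoc_of% h₁, h₄]
      · have h₇ : f ≫ p ≫ m = f := by
          have h₈ : f ≫ (𝟙 Y - φ) = 0 := by simp [hφ]
          rw [h₂, Preadditive.comp_sub, Category.assoc, reassoc_of% h₈]
          simp
        have := h₅ =≫ m
        simpa [h₇] using this

theorem exists_minimal_right (hFin : ∀ X Y : C, Module.Finite k (X ⟶ Y)) (hKS : IsKrullSchmidt C)
    (hsplit : ∀ {X Y : C} (s : X ⟶ Y) (r : Y ⟶ X), s ≫ r = 𝟙 X →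
      ∃ (K : C) (m : K ⟶ Y) (p : Y ⟶ K), m ≫ p = 𝟙 K ∧ p ≫ m = 𝟙 Y - r ≫ s)
    {X Y : C} (f : Y ⟶ X) :
    ∃ (Y' : C) (m : Y' ⟶ Y) (p : Y ⟶ Y'), m ≫ p = 𝟙 Y' ∧ p ≫ m ≫ f = f ∧
      ∀ φ : Y' ⟶ Y', φ ≫ m ≫ f = m ≫ f → IsIso φ := by
  induction hn : Module.finrank k (Y ⟶ Y) using Nat.strong_induction_on generalizing Y with
  | _ n ih =>
    by_cases H : ∀ φ : Y ⟶ Y, φ ≫ f = f → IsIso φ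
    · exact ⟨Y, 𝟙 Y, 𝟙 Y, by simp, by simp, by simpa using H⟩
    · push Not at H
      obtain ⟨φ, hφ, hφ'⟩ := H
      obtain ⟨L, s, r, hL, h⟩ := exists_split_of_not_isIso hKS φ hφ'
      obtain ⟨K, m, p, h₁, h₂, h₃⟩ := exists_retract hFin hsplit hL (s ≫ (𝟙 Y - φ)) r
        (by rw [Category.assoc, h])
      obtain ⟨Y', m', p', h₄, h₅, h₆⟩ := ih _ (hn ▸ h₃) (m ≫ f) rfl
      refine ⟨Y', m' ≫ m, p ≫ p', ?_, ?_, fun ψ hψ => h₆ ψ (by simpa using hψ)⟩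
      · rw [Category.assoc, reassoc_of% h₁, h₄]
      · have h₇ : p ≫ m ≫ f = f := by
          have h₈ : (𝟙 Y - φ) ≫ f = 0 := by simp [hφ]
          rw [← Category.assoc, h₂, Preadditive.sub_comp, Category.assoc, Category.assoc, h₈]
          simp
        have := p ≫= h₅
        simpa [h₇] using this

end KrullSchmidt

/-! ### Minimal approximations inside `E`-triangles -/

namespace ExtriangulatedStructure

section Minimal

variable {C : Type u} [Category.{v} C] [Preadditive C] [HasBinaryBiproducts C] [HasZeroObject C]
  {T : ExtriangulatedStructure.{w} C} {W : ObjectProperty C}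

theorem exists_split_complement (hWIC : T.WIC) {X Y : C} (s : X ⟶ Y) (r : Y ⟶ X)
    (h : s ≫ r = 𝟙 X) :
    ∃ (K : C) (m : K ⟶ Y) (p : Y ⟶ K), m ≫ p = 𝟙 K ∧ p ≫ m = 𝟙 Y - r ≫ s := by
  obtain ⟨K, e, he⟩ := exists_complement_of_retract hWIC s r h
  have h₀ : biprod.inl ≫ e.inv ≫ r = 0 := by rw [← he]; simp
  have h₁ : e.hom ≫ biprod.fst ≫ biprod.inl ≫ e.inv = 𝟙 Y - r ≫ biprod.inr ≫ e.inv := by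
    have : e.hom ≫ (biprod.fst ≫ biprod.inl + biprod.snd ≫ biprod.inr) ≫ e.inv = 𝟙 Y := by simp
    rw [eq_sub_iff_add_eq, ← he]
    simpa only [Preadditive.add_comp, Preadditive.comp_add, Category.assoc] using this
  have h₂ : biprod.inr ≫ e.inv ≫ r = 𝟙 X := by rw [← he]; simp
  refine ⟨K, biprod.inl ≫ e.inv, (𝟙 Y - r ≫ s) ≫ e.hom ≫ biprod.fst, ?_, ?_⟩
  · simp [reassoc_of% h₀]
  · simp only [Category.assoc]
    rw [h₁]
    simp [reassoc_of% h]

/-- A retract of the middle term of an `E`-triangle through which the inflation factors gives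
another `E`-triangle. -/
theorem IsCotorsionPair.exists_triangle_of_retract_left (hWIC : T.WIC) {P Q : ObjectProperty C}
    (h : T.IsCotorsionPair P Q) {X Y Y' U : C} {b : X ⟶ Y} {u : Y ⟶ U} (hb : T.IsTriangle b u)
    (hY : Q Y) (hU : P U) (m : Y' ⟶ Y) (p : Y ⟶ Y') (hmp : m ≫ p = 𝟙 Y') (hp : b ≫ p ≫ m = b) :
    ∃ (U' : C) (u' : Y' ⟶ U'), T.IsTriangle (b ≫ p) u' ∧ P U' ∧ Q Y' := by
  obtain ⟨U', u', hu'⟩ := (hWIC (b ≫ p) m).1 (by rw [Category.assoc, hp]; exact ⟨U, u, hb⟩)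
  refine ⟨U', u', hu', h.mem_left fun D hD ε => ?_, mem_of_retract hWIC h.right m p hmp hY⟩
  obtain ⟨δ, hδ⟩ := hb
  obtain ⟨δ', hδ'⟩ := hu'
  obtain ⟨c, hc, -⟩ := T.et3 _ _ _ _ _ _ hδ hδ' (𝟙 X) p (by simp)
  -- Since `u' = m ≫ u ≫ c` passes through `U` and `E(U, D) = 0`, the class `ε` dies on `Y'`. So `ε
  -- = a_* δ'`, and this is zero because `a` extends over `b`, hence over `b ≫ p`.
  have h₁ : extPull T.E u' ε = 0 := by
    have h₂ : extPull T.E (m ≫ u ≫ c) ε = 0 := by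
      rw [← Category.assoc, extPull_comp, h.ext_eq_zero U D hU hD (extPull T.E c ε), extPull_zero]
    rwa [hc, reassoc_of% hmp] at h₂
  obtain ⟨a, rfl⟩ := hδ'.exists_push_of_pull_eq_zero ε h₁
  rw [← hδ'.exists_extend_iff]
  obtain ⟨g, hg⟩ := (hδ.exists_extend_iff a).2 (h.ext_eq_zero U D hU hD _)
  exact ⟨m ≫ g, by rw [Category.assoc, ← Category.assoc p, ← Category.assoc b, hp, hg]⟩

theorem IsCotorsionPair.exists_triangle_of_retract_right (hWIC : T.WIC) {P Q : ObjectProperty C}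
    (h : T.IsCotorsionPair P Q) {X Y Y' V : C} {i : V ⟶ Y} {z : Y ⟶ X} (hz : T.IsTriangle i z)
    (hV : Q V) (hY : P Y) (m : Y' ⟶ Y) (p : Y ⟶ Y') (hmp : m ≫ p = 𝟙 Y') (hp : p ≫ m ≫ z = z) :
    ∃ (V' : C) (i' : V' ⟶ Y'), T.IsTriangle i' (m ≫ z) ∧ Q V' ∧ P Y' := by
  obtain ⟨V', i', hi'⟩ := (hWIC p (m ≫ z)).2 (by rw [hp]; exact ⟨V, i, hz⟩)
  refine ⟨V', i', hi', h.mem_right fun D hD ε => ?_, mem_of_retract hWIC h.left m p hmp hY⟩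
  obtain ⟨δ, hδ⟩ := hz
  obtain ⟨δ', hδ'⟩ := hi'
  obtain ⟨c, hc, -⟩ := T.et3_op _ _ _ _ _ _ hδ' hδ m (𝟙 X) (by simp)
  have h₁ : extPush T.E i' ε = 0 := by
    have h₂ : extPush T.E ((c ≫ i) ≫ p) ε = 0 := by
      rw [extPush_comp, extPush_comp, h.ext_eq_zero D V hD hV (extPush T.E c ε), extPush_zero,
        extPush_zero]
    rwa [← hc, Category.assoc, hmp, Category.comp_id] at h₂
  obtain ⟨a, rfl⟩ := hδ'.exists_pull_of_push_eq_zero ε h₁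
  rw [← hδ'.exists_factor_iff]
  obtain ⟨g, hg⟩ := (hδ.exists_factor_iff a).2 (h.ext_eq_zero D V hD hV _)
  exact ⟨g ≫ p, by rw [Category.assoc, hp, hg]⟩

variable {k : Type*} [Field k] [Linear k C]

theorem exists_isMinimalLeftApprox (hFin : ∀ X Y : C, Module.Finite k (X ⟶ Y))
    (hKS : IsKrullSchmidt C) (hWIC : T.WIC) {P Q : ObjectProperty C} (h : T.IsCotorsionPair P Q)
    (X : C) :
    ∃ (Y U : C) (b : X ⟶ Y) (u : Y ⟶ U), T.IsTriangle b u ∧ P U ∧ IsMinimalLeftApprox Q b := by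
  obtain ⟨Y, U, b, u, hY, hU, hb⟩ := h.mem_cocone X
  obtain ⟨Y', m, p, h₁, h₂, h₃⟩ := exists_minimal_left hFin hKS (exists_split_complement hWIC) b
  obtain ⟨U', u', h₄, h₅, h₆⟩ := h.exists_triangle_of_retract_left hWIC hb hY hU m p h₁ h₂
  exact ⟨Y', U', b ≫ p, u', h₄, h₅, h₆,
    fun Y'' g hY'' => h₄.exists_extend (h.ext_eq_zero U' Y'' h₅ hY'') g, h₃⟩

theorem exists_isMinimalRightApprox (hFin : ∀ X Y : C, Module.Finite k (X ⟶ Y))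
    (hKS : IsKrullSchmidt C) (hWIC : T.WIC) {P Q : ObjectProperty C} (h : T.IsCotorsionPair P Q)
    (X : C) :
    ∃ (V Y : C) (i : V ⟶ Y) (z : Y ⟶ X), T.IsTriangle i z ∧ Q V ∧ IsMinimalRightApprox P z := by
  obtain ⟨V, Y, i, z, hV, hY, hz⟩ := h.mem_cone X
  obtain ⟨Y', m, p, h₁, h₂, h₃⟩ := exists_minimal_right hFin hKS (exists_split_complement hWIC) z
  obtain ⟨V', i', h₄, h₅, h₆⟩ := h.exists_triangle_of_retract_right hWIC hz hV hY m p h₁ h₂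
  exact ⟨V', Y', i', m ≫ z, h₄, h₅, h₆,
    fun Y'' g hY'' => h₄.exists_factor (h.ext_eq_zero Y'' V' hY'' h₅) g, h₃⟩

theorem exists_isMinimal (hFin : ∀ X Y : C, Module.Finite k (X ⟶ Y)) (hKS : IsKrullSchmidt C)
    (hProj : T.HasEnoughProjectives) (hWIC : T.WIC) (hW : T.IsPresilting W) (hCP : T.CP W) :
    ∃ A : T.ApproxChoice W, A.IsMinimal := by
  choose plus U b u h₁ h₂ h₃ using exists_isMinimalLeftApprox hFin hKS hWIC hCP.1
  choose V Z i z h₄ h₅ h₆ using exists_isMinimalRightApprox hFin hKS hWIC hCP.2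
  exact ⟨{ plus := plus, U := U, b := b, u := u, triangle_plus := h₁
           plus_mem := fun X => (h₃ X).1
           U_mem := h₂
           V := fun X => V (plus X)
           Z := fun X => Z (plus X)
           i := fun X => i (plus X)
           z := fun X => z (plus X)
           triangle_Z := fun X => h₄ (plus X)
           V_mem := fun X => h₅ (plus X)
           -- `Z` is also in `W^⊥`, being an extension of `X⁺` by an object of `W^∧`.
           Z_mem := fun X => ⟨(h₆ (plus X)).1,
            rightPerp_middle (h₄ (plus X)) (wedge_le_rightPerp hProj hW _ (h₅ (plus X)))
              (h₃ X).1⟩ }, fun X => ⟨h₃ X, h₆ (plus X)⟩⟩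

end Minimal

end ExtriangulatedStructure

theorem theorem3p10 {k : Type*} [Field k] {B : Type u} [Category.{v} B] [Preadditive B]
    [Linear k B] [HasZeroObject B] [HasBinaryBiproducts B] [EssentiallySmall.{v} B]
    (hFin : ∀ X Y : B, Module.Finite k (X ⟶ Y)) (hKS : IsKrullSchmidt B)
    (T : ExtriangulatedStructure.{w} B)
    (hProj : T.HasEnoughProjectives) (hInj : T.HasEnoughInjectives) (hWIC : T.WIC)
    (W : ObjectProperty B) (hW : T.IsPresilting W) (hCP : T.CP W) :
    Nonempty (T.thickLocalization W ≌ T.subfactor W) ∧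
    (∃ A : T.ApproxChoice W, A.IsMinimal) ∧
    ∀ A : T.ApproxChoice W, ∃ (G : A.InducedFunctor)
      (hG : (T.thickInflations W).IsInvertedBy G.functor),
      (Localization.Construction.lift G.functor hG).IsEquivalence := by
  have key : ∀ A : T.ApproxChoice W, ∃ (G : A.InducedFunctor)
      (hG : (T.thickInflations W).IsInvertedBy G.functor),
      (Localization.Construction.lift G.functor hG).IsEquivalence := fun A => by
    obtain ⟨G⟩ := A.exists_inducedFunctor hW hCP
    have hG := G.inverts hProj hWIC hW hCP
    exact ⟨G, hG, G.isEquivalence_lift hW hCP hG⟩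
  have hmin := ExtriangulatedStructure.exists_isMinimal hFin hKS hProj hWIC hW hCP
  obtain ⟨A, -⟩ := id hmin
  obtain ⟨G, hG, h⟩ := key A
  exact ⟨⟨(Localization.Construction.lift G.functor hG).asEquivalence⟩, hmin, key⟩
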